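/- Let $\mathfrak X=(X,\{R_i\}_{i=0}^d)$ be a symmetric association scheme of class $d$ on a finite set $X$: the $R_i$ are nonempty symmetric relations partitioning $X\times X$, $R_0$ is the diagonal, and for all $i,j,k$ the number of $z\in X$ with $(x,z)\in R_i$ and $(z,y)\in R_j$ is the same for all $(x,y)\in R_k$. Let $A_i$ be the adjacency matrix of $R_i$, and let $E_0,\dots,E_d$ be an ordering of the primitive idempotents of the Bose–Mesner algebra $\mathbb C[A_0,\dots,A_d]$, that is, a basis of this algebra with $E_0=|X|^{-1}J$ (where $J$ is the all-ones matrix), $\sum_i E_i=I$ and $E_iE_j=\delta_{ij}E_i$. Define $p_i(j)$ and $q_i(j)$ by $A_i=\sum_{j=0}^d p_i(j)E_j$ and $E_i=|X|^{-1}\sum_{j=0}^d q_i(j)A_j$, and put $m_i=q_i(0)$ and $\theta_i^*=q_1(i)$. Suppose that $\mathfrak X$ is $Q$-polynomial with respect to the ordering $\{E_i\}_{i=0}^d$, i.e. for each $i\in\{0,\dots,d\}$ there is a polynomial $v_i^*$ of degree $i$ with $q_i(j)=v_i^*(q_1(j))$ for all $j\in\{0,\dots,d\}$, and that $m_1>2$.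 If there is an odd integer $t$ with $1\le t\le d/2$ and $m_t\neq m_{d-t+1}$, then for every $j\in\{1,\dots,d\}$ the generalized Larman–Rogers–Seidel ratio $$K_j=\prod_{\substack{k=1\\k\ne j}}^d\frac{\theta_0^*-\theta_k^*}{\theta_j^*-\theta_k^*}$$ satisfies $K_j=-p_j(d)$ and is a rational integer. -/

import Mathlib

noncomputable section

/-- A symmetric association scheme of class `d` on the finite set `X`. -/
structure SymmAssocScheme (X : Type*) [Fintype X] (d : ℕ) where
  /-- The relations `R_0, …, R_d`. -/
  R : Fin (d + 1) → Set (X × X)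
  nonempty : ∀ i, (R i).Nonempty
  zero_eq : R 0 = {a | a.1 = a.2}
  cover : ⋃ i, R i = Set.univ
  disjoint : ∀ i j, i ≠ j → Disjoint (R i) (R j)
  symm : ∀ i x y, (x, y) ∈ R i → (y, x) ∈ R i
  /-- Existence of the intersection numbers `p_{ij}^k`. -/
  regular : ∀ i j k, ∃ n : ℕ, ∀ x y, (x, y) ∈ R k →
    {z : X | (x, z) ∈ R i ∧ (z, y) ∈ R j}.ncard = n

namespace SymmAssocScheme

variable {X : Type*} [Fintype X] {d : ℕ}

open Classical in
/-- The `i`-th adjacency matrix. -/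
def A (S : SymmAssocScheme X d) (i : Fin (d + 1)) : Matrix X X ℂ :=
  Matrix.of fun x y => if (x, y) ∈ S.R i then 1 else 0

theorem exists_mem (S : SymmAssocScheme X d) (x y : X) : ∃ k, (x, y) ∈ S.R k := by
  have h : (x, y) ∈ ⋃ i, S.R i := by rw [S.cover]; trivial
  simpa using h

theorem A_apply (S : SymmAssocScheme X d) {i k : Fin (d + 1)} {x y : X}
    (h : (x, y) ∈ S.R k) : S.A i x y = if i = k then 1 else 0 := by
  unfold A
  rw [Matrix.of_apply]
  by_cases hik : i = k
  · subst hik; simp [h]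
  · have : (x, y) ∉ S.R i := fun h' => Set.disjoint_left.mp (S.disjoint i k hik) h' h
    simp [this, hik]

theorem sum_A_apply (S : SymmAssocScheme X d) (g : Fin (d + 1) → ℂ) {k : Fin (d + 1)} {x y : X}
    (h : (x, y) ∈ S.R k) : (∑ i, g i • S.A i) x y = g k := by
  simp [Matrix.sum_apply, S.A_apply h]

theorem linearIndependent_A (S : SymmAssocScheme X d) : LinearIndependent ℂ S.A := by
  rw [Fintype.linearIndependent_iff]
  intro g hg k
  obtain ⟨⟨x, y⟩, h⟩ := S.nonempty k
  rw [← S.sum_A_apply g h, hg, Matrix.zero_apply]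

theorem A_mul_A_mem (S : SymmAssocScheme X d) (i j : Fin (d + 1)) :
    S.A i * S.A j ∈ Submodule.span ℂ (Set.range S.A) := by
  classical
  choose n hn using S.regular i j
  have : S.A i * S.A j = ∑ k, (n k : ℂ) • S.A k := by
    ext x y
    obtain ⟨k, hk⟩ := S.exists_mem x y
    rw [S.sum_A_apply _ hk, ← hn k x y hk, Matrix.mul_apply, Set.ncard_eq_toFinset_card']
    simp only [A, Matrix.of_apply, Set.toFinset_ofFinset, ← ite_and, mul_ite, mul_one, mul_zero]
    rw [Finset.sum_boole]
    congr 2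
    ext z
    simp [and_comm]
  rw [this]
  exact Submodule.sum_mem _ fun k _ => Submodule.smul_mem _ _ (Submodule.subset_span ⟨k, rfl⟩)

variable [DecidableEq X]

/-- The Bose–Mesner algebra: the complex algebra generated by the adjacency matrices. -/
def boseMesner (S : SymmAssocScheme X d) : Subalgebra ℂ (Matrix X X ℂ) :=
  Algebra.adjoin ℂ (Set.range S.A)

theorem A_mem (S : SymmAssocScheme X d) (i : Fin (d + 1)) : S.A i ∈ S.boseMesner :=
  Algebra.subset_adjoin ⟨i, rfl⟩

theorem A_zero (S : SymmAssocScheme X d) : S.A 0 = 1 := by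
  ext x y
  by_cases h : x = y <;> simp [A, S.zero_eq, Matrix.one_apply, h]

/-- The adjacency matrices span the Bose–Mesner algebra. -/
theorem span_A (S : SymmAssocScheme X d) :
    Submodule.span ℂ (Set.range S.A) = Subalgebra.toSubmodule S.boseMesner := by
  apply le_antisymm
  · rw [Submodule.span_le]
    rintro _ ⟨i, rfl⟩
    exact S.A_mem i
  · intro M hM
    have hM' : M ∈ Algebra.adjoin ℂ (Set.range S.A) := hM
    induction hM' using Algebra.adjoin_induction with
    | mem x hx => exact Submodule.subset_span hx
    | algebraMap r =>
      rw [Algebra.algebraMap_eq_smul_one, ← S.A_zero]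
      exact Submodule.smul_mem _ _ (Submodule.subset_span ⟨0, rfl⟩)
    | add x y hx hy ihx ihy => exact Submodule.add_mem _ (ihx hx) (ihy hy)
    | mul x y hx hy ihx ihy =>
      have h := Submodule.mul_mem_mul (ihx hx) (ihy hy)
      rw [Submodule.span_mul_span] at h
      refine Submodule.span_le.mpr ?_ h
      rintro _ ⟨_, ⟨i, rfl⟩, _, ⟨j, rfl⟩, rfl⟩
      exact S.A_mul_A_mem i j

/-- An ordering `E_0, …, E_d` of the primitive idempotents of the scheme, that is, a basis of the
Bose–Mesner algebra with `E_0 = |X|⁻¹ J`, `∑ E_i = I` and `E_i E_j = δ_{ij} E_i`. -/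
structure PrimitiveIdempotents (S : SymmAssocScheme X d) where
  E : Fin (d + 1) → Matrix X X ℂ
  linearIndependent : LinearIndependent ℂ E
  span_eq : Submodule.span ℂ (Set.range E) = Subalgebra.toSubmodule S.boseMesner
  zero_eq : E 0 = (Fintype.card X : ℂ)⁻¹ • Matrix.of fun _ _ => 1
  sum_eq : ∑ i, E i = 1
  mul_eq : ∀ i j, E i * E j = if i = j then E i else 0

namespace PrimitiveIdempotents

variable {S : SymmAssocScheme X d} (B : S.PrimitiveIdempotents)

theorem A_mem_span (i : Fin (d + 1)) : S.A i ∈ Submodule.span ℂ (Set.range B.E) := by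
  rw [B.span_eq]; exact S.A_mem i

theorem E_mem_span (i : Fin (d + 1)) : B.E i ∈ Submodule.span ℂ (Set.range S.A) := by
  rw [S.span_A, ← B.span_eq]; exact Submodule.subset_span ⟨i, rfl⟩

/-- `p_i(j)`: the coefficient of `E_j` in `A_i = ∑ j, p_i(j) E_j`. -/
def p (i j : Fin (d + 1)) : ℂ :=
  B.linearIndependent.repr ⟨S.A i, B.A_mem_span i⟩ j

/-- `q_i(j)`: `|X|` times the coefficient of `A_j` in `E_i`, so `E_i = |X|⁻¹ ∑ j, q_i(j) A_j`. -/
def q (i j : Fin (d + 1)) : ℂ :=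
  (Fintype.card X : ℂ) * S.linearIndependent_A.repr ⟨B.E i, B.E_mem_span i⟩ j

theorem A_eq_sum (i : Fin (d + 1)) : S.A i = ∑ j, B.p i j • B.E j := by
  have h := B.linearIndependent.linearCombination_repr ⟨S.A i, B.A_mem_span i⟩
  rw [Finsupp.linearCombination_apply, Finsupp.sum_fintype _ _ (by simp)] at h
  exact h.symm

theorem E_eq_sum (i : Fin (d + 1)) :
    B.E i = (Fintype.card X : ℂ)⁻¹ • ∑ j, B.q i j • S.A j := by
  have hX : (Fintype.card X : ℂ) ≠ 0 := by
    obtain ⟨⟨x, _⟩, _⟩ := S.nonempty 0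
    have : Nonempty X := ⟨x⟩
    exact_mod_cast Fintype.card_ne_zero
  have h := S.linearIndependent_A.linearCombination_repr ⟨B.E i, B.E_mem_span i⟩
  rw [Finsupp.linearCombination_apply, Finsupp.sum_fintype _ _ (by simp)] at h
  simp only [q, mul_smul, ← Finset.smul_sum]
  rw [inv_smul_smul₀ hX]
  exact h.symm

/-- The multiplicity `m_i = q_i(0)`. -/
def m (i : Fin (d + 1)) : ℂ := B.q i 0

/-- The dual eigenvalue `θ*_i = q_1(i)`. -/
def dualEigenvalue (i : Fin (d + 1)) : ℂ := B.q 1 i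

/-- The scheme is `Q`-polynomial with respect to the ordering `E_0, …, E_d`. -/
def IsQPolynomial : Prop :=
  ∀ i : Fin (d + 1), ∃ v : Polynomial ℂ, v.degree = ((i : ℕ) : WithBot ℕ) ∧
    ∀ j, B.q i j = v.eval (B.q 1 j)

/-- The generalized Larman–Rogers–Seidel ratio
`K_i = ∏_{1 ≤ j ≤ d, j ≠ i} (θ*_0 - θ*_j) / (θ*_i - θ*_j)` (for `1 ≤ i ≤ d`). -/
def K (i : Fin (d + 1)) : ℂ :=
  ∏ j ∈ Finset.univ.filter (fun j : Fin (d + 1) => j ≠ 0 ∧ j ≠ i),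
    (B.dualEigenvalue 0 - B.dualEigenvalue j) / (B.dualEigenvalue i - B.dualEigenvalue j)

end PrimitiveIdempotents

end SymmAssocScheme

end

/-! The formula for `K j` is an interpolation argument. The polynomial with roots θ*_k for k ≠ 0, j
has degree d - 1, so applying it to the entries of |X|E_1 gives a combination of E_0, …, E_{d-1},
which E_d annihilates. The same matrix is a combination of I and A_j, and comparing the two gives
K_j = -p_j(d) (`IsQPolynomial.K_eq`).

Integrality is Galois-theoretic. Since p_j(d) is an algebraic integer, it suffices that every
automorphism σ of ℂ fixes it. Such a σ permutes the E_i, fixing E_0, the multiplicities, and the set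
of triples with nonzero Krein parameter q_{ij}^k. So p_j(d) is fixed once the permutation fixes d.

The permutation is controlled by combinatorics alone (`Aut.last_or_reflect`): it fixes d, or it
sends t to d + 1 - t for every odd t ≤ d/2. The hypothesis m_t ≠ m_{d-t+1} excludes the latter.
Besides the triangle inequality and nonvanishing in its equality cases, this uses three facts:
q_{1i}^i = 0 forces q_{11}^1 = 0; both vanishing forces q_{2i}^i ≠ 0 when m_1 ≠ 2 (1 ≤ i < d in
both); and q_{11}^1 = 0 ≠ q_{12}^2 forces q_{22}^3 ≠ 0.

Let V_j be the column space of E_j. The Krein parameter vanishes iff pointwise multiplication by V_j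
has no component from V_k to V_i, so the three facts follow from manipulating paths of blocks E_i Δ
E_k, using that the diagonal matrices Δ commute. -/

section

open Matrix Finset
open scoped ComplexOrder

/-- The trace of an idempotent matrix is its rank. -/
theorem Matrix.trace_eq_rank_of_isIdempotentElem {n K : Type*} [Fintype n] [DecidableEq n] [Field K]
    (M : Matrix n n K) (hM : IsIdempotentElem M) : M.trace = (M.rank : K) := by
  have h1 : IsIdempotentElem (Matrix.toLin' M) := by
    unfold IsIdempotentElem
    rw [Module.End.mul_eq_comp, ← Matrix.toLin'_mul, hM.eq]
  have h := (LinearMap.isProj_range_iff_isIdempotentElem (Matrix.toLin' M)).mpr h1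
  rw [← Matrix.trace_toLin'_eq, h.trace, Matrix.rank, Matrix.toLin'_apply']

theorem Matrix.trace_mul_hadamard {n R : Type*} [Fintype n] [CommSemiring R]
    (L M N : Matrix n n R) : (L * (M ⊙ N)).trace = ∑ x, ∑ y, L x y * M y x * N y x := by
  simp [Matrix.trace, Matrix.mul_apply, mul_assoc]

/-! ### The Bose–Mesner algebra, its idempotents and Krein parameters. -/

namespace SymmAssocScheme

variable {X : Type*} [Fintype X] {d : ℕ}

theorem A_transpose (S : SymmAssocScheme X d) (i : Fin (d + 1)) : (S.A i)ᵀ = S.A i := by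
  ext x y
  have h : (y, x) ∈ S.R i ↔ (x, y) ∈ S.R i := ⟨S.symm i y x, S.symm i x y⟩
  by_cases hx : (x, y) ∈ S.R i
  · simp [A, hx, h.mpr hx]
  · simp [A, hx, mt h.mp hx]

theorem A_conjTranspose (S : SymmAssocScheme X d) (i : Fin (d + 1)) : (S.A i)ᴴ = S.A i := by
  ext x y
  have h : (y, x) ∈ S.R i ↔ (x, y) ∈ S.R i := ⟨S.symm i y x, S.symm i x y⟩
  by_cases hx : (x, y) ∈ S.R i
  · simp [A, hx, h.mpr hx]
  · simp [A, hx, mt h.mp hx]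

theorem card_ne_zero (S : SymmAssocScheme X d) : (Fintype.card X : ℂ) ≠ 0 := by
  obtain ⟨⟨x, _⟩, _⟩ := S.nonempty 0
  have : Nonempty X := ⟨x⟩
  exact_mod_cast Fintype.card_ne_zero

variable [DecidableEq X]

theorem mem_boseMesner_iff (S : SymmAssocScheme X d) {M : Matrix X X ℂ} :
    M ∈ S.boseMesner ↔ ∃ c : Fin (d + 1) → ℂ, M = ∑ i, c i • S.A i := by
  rw [← Subalgebra.mem_toSubmodule, ← S.span_A, Submodule.mem_span_range_iff_exists_fun]
  simp only [eq_comm]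

theorem hadamard_mem (S : SymmAssocScheme X d) {M N : Matrix X X ℂ}
    (hM : M ∈ S.boseMesner) (hN : N ∈ S.boseMesner) : M ⊙ N ∈ S.boseMesner := by
  rw [S.mem_boseMesner_iff] at *
  obtain ⟨c, rfl⟩ := hM
  obtain ⟨e, rfl⟩ := hN
  refine ⟨fun i => c i * e i, ?_⟩
  ext x y
  obtain ⟨k, hk⟩ := S.exists_mem x y
  rw [hadamard_apply, S.sum_A_apply _ hk, S.sum_A_apply _ hk, S.sum_A_apply _ hk]

theorem transpose_eq_of_mem (S : SymmAssocScheme X d) {M : Matrix X X ℂ}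
    (hM : M ∈ S.boseMesner) : Mᵀ = M := by
  obtain ⟨c, rfl⟩ := S.mem_boseMesner_iff.mp hM
  simp [transpose_sum, S.A_transpose]

theorem conjTranspose_mem (S : SymmAssocScheme X d) {M : Matrix X X ℂ}
    (hM : M ∈ S.boseMesner) : Mᴴ ∈ S.boseMesner := by
  obtain ⟨c, rfl⟩ := S.mem_boseMesner_iff.mp hM
  refine S.mem_boseMesner_iff.mpr ⟨fun i => star (c i), ?_⟩
  simp [conjTranspose_sum, S.A_conjTranspose]

namespace PrimitiveIdempotents

variable {S : SymmAssocScheme X d} (B : S.PrimitiveIdempotents)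

theorem E_mem (i : Fin (d + 1)) : B.E i ∈ S.boseMesner := by
  rw [← Subalgebra.mem_toSubmodule, ← B.span_eq]
  exact Submodule.subset_span ⟨i, rfl⟩

theorem E_ne_zero (i : Fin (d + 1)) : B.E i ≠ 0 := B.linearIndependent.ne_zero i

theorem mem_boseMesner_iff {M : Matrix X X ℂ} :
    M ∈ S.boseMesner ↔ ∃ c : Fin (d + 1) → ℂ, M = ∑ i, c i • B.E i := by
  rw [← Subalgebra.mem_toSubmodule, ← B.span_eq, Submodule.mem_span_range_iff_exists_fun]
  simp only [eq_comm]

theorem sum_smul_E_mul_E (c : Fin (d + 1) → ℂ) (k : Fin (d + 1)) :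
    (∑ i, c i • B.E i) * B.E k = c k • B.E k := by
  simp [Finset.sum_mul, B.mul_eq]

theorem E_mul_sum_smul_E (c : Fin (d + 1) → ℂ) (k : Fin (d + 1)) :
    B.E k * (∑ i, c i • B.E i) = c k • B.E k := by
  simp [Finset.mul_sum, B.mul_eq]

theorem trace_E_eq_rank (i : Fin (d + 1)) : (B.E i).trace = ((B.E i).rank : ℂ) :=
  Matrix.trace_eq_rank_of_isIdempotentElem _ (by simp [IsIdempotentElem, B.mul_eq])

theorem rank_E_ne_zero (i : Fin (d + 1)) : (B.E i).rank ≠ 0 := by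
  intro h
  refine B.E_ne_zero i ((Matrix.toLin').map_eq_zero_iff.mp ?_)
  rw [← LinearMap.range_eq_bot, ← Submodule.finrank_eq_zero (R := ℂ)]
  exact h

theorem trace_E_ne_zero (i : Fin (d + 1)) : (B.E i).trace ≠ 0 := by
  rw [trace_E_eq_rank]
  exact_mod_cast B.rank_E_ne_zero i

theorem E_apply {i k : Fin (d + 1)} {x y : X} (h : (x, y) ∈ S.R k) :
    B.E i x y = (Fintype.card X : ℂ)⁻¹ * B.q i k := by
  rw [B.E_eq_sum, Matrix.smul_apply, S.sum_A_apply _ h, smul_eq_mul]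

theorem m_eq_trace (i : Fin (d + 1)) : B.m i = (B.E i).trace := by
  have h : ∀ x : X, B.E i x x = (Fintype.card X : ℂ)⁻¹ * B.m i := fun x =>
    B.E_apply (k := 0) (by simp [S.zero_eq])
  simp [Matrix.trace, h, S.card_ne_zero]

/-- The primitive idempotents are Hermitian. -/
theorem E_conjTranspose (i : Fin (d + 1)) : (B.E i)ᴴ = B.E i := by
  obtain ⟨c, hc⟩ := B.mem_boseMesner_iff.mp (S.conjTranspose_mem (B.E_mem i))
  have hidem : ∀ k, c k = 0 ∨ c k = 1 := fun k => by
    have h1 : (B.E i)ᴴ * (B.E i)ᴴ = (B.E i)ᴴ := by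
      rw [← conjTranspose_mul, B.mul_eq, if_pos rfl]
    have h2 : (c k * c k) • B.E k = c k • B.E k := by
      rw [← B.sum_smul_E_mul_E c k, ← hc]
      conv_rhs => rw [← h1, Matrix.mul_assoc, hc, B.sum_smul_E_mul_E, mul_smul_comm,
        B.sum_smul_E_mul_E, smul_smul]
    have h3 := smul_left_injective ℂ (B.E_ne_zero k) h2
    rcases eq_or_ne (c k) 0 with h | h
    · exact Or.inl h
    · exact Or.inr (mul_left_cancel₀ h (by simpa using h3))
  have hi : c i = 1 := by
    refine (hidem i).resolve_left fun h0 => B.E_ne_zero i ?_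
    have := B.sum_smul_E_mul_E c i
    rw [← hc, h0, zero_smul] at this
    exact conjTranspose_mul_self_eq_zero.mp this
  have htr : ∑ k, c k * (B.E k).trace = (B.E i).trace := by
    have h1 : ((B.E i)ᴴ).trace = (B.E i).trace := by
      rw [trace_conjTranspose, B.trace_E_eq_rank]; simp
    rw [← h1, hc, trace_sum]
    simp
  -- Traces are positive integers (ranks), and the term k = i already accounts for the whole trace
  -- of E_i, so no other idempotent can occur.
  have hz : ∀ k, k ≠ i → c k = 0 := by
    choose e he using fun k => show ∃ e : ℕ, c k = e from
      (hidem k).elim (fun h => ⟨0, by simpa using h⟩) (fun h => ⟨1, by simpa using h⟩)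
    simp only [he, B.trace_E_eq_rank] at htr hi ⊢
    norm_cast at htr hi ⊢
    rw [← Finset.add_sum_erase _ _ (Finset.mem_univ i), hi, one_mul] at htr
    have h0 : ∑ k ∈ univ.erase i, e k * (B.E k).rank = 0 := by omega
    intro k hk
    have := Finset.sum_eq_zero_iff.mp h0 k (by simpa using hk)
    exact (mul_eq_zero.mp this).resolve_right (B.rank_E_ne_zero k)
  rw [hc, Finset.sum_eq_single i (fun k _ hk => by simp [hz k hk]) (by simp), hi, one_smul]

theorem A_mul_E (i k : Fin (d + 1)) : S.A i * B.E k = B.p i k • B.E k := by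
  rw [B.A_eq_sum i, B.sum_smul_E_mul_E]

/-- The primitive idempotents indexed by `ℕ`, with value zero beyond `d`. -/
noncomputable def idem (i : ℕ) : Matrix X X ℂ := if h : i < d + 1 then B.E ⟨i, h⟩ else 0

theorem idem_of_le {i : ℕ} (h : i ≤ d) : B.idem i = B.E ⟨i, Nat.lt_succ_of_le h⟩ := by
  rw [idem, dif_pos]

theorem idem_of_lt {i : ℕ} (h : d < i) : B.idem i = 0 := dif_neg (by omega)

theorem idem_val (i : Fin (d + 1)) : B.idem i = B.E i := dif_pos i.2

theorem idem_mem (i : ℕ) : B.idem i ∈ S.boseMesner := by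
  rcases le_or_gt i d with h | h
  · rw [B.idem_of_le h]; exact B.E_mem _
  · rw [B.idem_of_lt h]; exact zero_mem _

theorem idem_transpose (i : ℕ) : (B.idem i)ᵀ = B.idem i := S.transpose_eq_of_mem (B.idem_mem i)

theorem idem_symm (i : ℕ) (x y : X) : B.idem i x y = B.idem i y x := by
  conv_lhs => rw [← B.idem_transpose i, transpose_apply]

theorem idem_conjTranspose (i : ℕ) : (B.idem i)ᴴ = B.idem i := by
  rcases le_or_gt i d with h | h
  · rw [B.idem_of_le h]; exact B.E_conjTranspose _
  · rw [B.idem_of_lt h]; simp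

theorem star_idem (i : ℕ) (x y : X) : star (B.idem i x y) = B.idem i x y := by
  rw [← conjTranspose_apply, B.idem_conjTranspose, B.idem_symm]

theorem idem_mul_self (i : ℕ) : B.idem i * B.idem i = B.idem i := by
  rcases le_or_gt i d with h | h
  · rw [B.idem_of_le h, B.mul_eq, if_pos rfl]
  · simp [B.idem_of_lt h]

theorem idem_mul_of_ne {i j : ℕ} (hij : i ≠ j) : B.idem i * B.idem j = 0 := by
  rcases le_or_gt i d with h | h
  · rcases le_or_gt j d with h' | h'
    · rw [B.idem_of_le h, B.idem_of_le h', B.mul_eq, if_neg (by simpa using hij)]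
    · simp [B.idem_of_lt h']
  · simp [B.idem_of_lt h]

theorem sum_idem : ∑ i ∈ range (d + 1), B.idem i = 1 := by
  rw [Finset.sum_range, ← B.sum_eq]
  simp [idem_val]

theorem idem_ne_zero {i : ℕ} (h : i ≤ d) : B.idem i ≠ 0 := by
  rw [B.idem_of_le h]; exact B.E_ne_zero _

theorem trace_idem_ne_zero {i : ℕ} (h : i ≤ d) : (B.idem i).trace ≠ 0 := by
  rw [B.idem_of_le h]; exact B.trace_E_ne_zero _

theorem exists_mul_idem {M : Matrix X X ℂ} (hM : M ∈ S.boseMesner) (k : ℕ) :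
    ∃ c : ℂ, M * B.idem k = c • B.idem k ∧ B.idem k * M = c • B.idem k := by
  rcases le_or_gt k d with h | h
  · rw [B.idem_of_le h]
    obtain ⟨c, rfl⟩ := B.mem_boseMesner_iff.mp hM
    exact ⟨_, B.sum_smul_E_mul_E c _, B.E_mul_sum_smul_E c _⟩
  · exact ⟨0, by simp [B.idem_of_lt h]⟩

theorem idem_mul_mul_idem_of_ne {M : Matrix X X ℂ} (hM : M ∈ S.boseMesner) {i j : ℕ}
    (hij : i ≠ j) : B.idem i * M * B.idem j = 0 := by
  obtain ⟨c, h, -⟩ := B.exists_mul_idem hM j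
  rw [Matrix.mul_assoc, h, mul_smul_comm, B.idem_mul_of_ne hij, smul_zero]

/-- The sum of the entries of `E_i ∘ E_j ∘ E_k`. Up to a positive factor, this is the Krein
parameter `q_{ij}^k`. -/
noncomputable def triple (i j k : ℕ) : ℂ :=
  ∑ x, ∑ y, B.idem i x y * B.idem j x y * B.idem k x y

theorem triple_swap (i j k : ℕ) : B.triple i j k = B.triple j i k := by
  simp only [triple, mul_comm (B.idem i _ _)]

theorem triple_rotate (i j k : ℕ) : B.triple i j k = B.triple k i j := by
  unfold triple
  refine Finset.sum_congr rfl fun x _ => Finset.sum_congr rfl fun y _ => by ring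

theorem trace_idem_mul_hadamard (i j k : ℕ) :
    (B.idem i * (B.idem j ⊙ B.idem k)).trace = B.triple i j k := by
  rw [trace_mul_hadamard, triple]
  refine Finset.sum_congr rfl fun x _ => Finset.sum_congr rfl fun y _ => ?_
  rw [B.idem_symm j, B.idem_symm k]

/-- Taking traces shows that c times the trace of E_k is the triple sum. Later arguments cancel c
when the Krein parameter is nonzero. -/
theorem exists_hadamard_mul_idem (i j k : ℕ) :
    ∃ c : ℂ, (B.idem i ⊙ B.idem j) * B.idem k = c • B.idem k ∧
      B.idem k * (B.idem i ⊙ B.idem j) = c • B.idem k ∧ (B.triple i j k ≠ 0 → c ≠ 0) := by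
  obtain ⟨c, h1, h2⟩ := B.exists_mul_idem (S.hadamard_mem (B.idem_mem i) (B.idem_mem j)) k
  refine ⟨c, h1, h2, fun hT hc => hT ?_⟩
  rw [B.triple_rotate, ← B.trace_idem_mul_hadamard, h2, hc, zero_smul, trace_zero]

/-- The diagonal matrix with the entries of the row `z` of `E_j`. -/
noncomputable def dg (j : ℕ) (z : X) : Matrix X X ℂ := diagonal (B.idem j z)

theorem dg_transpose (j : ℕ) (z : X) : (B.dg j z)ᵀ = B.dg j z := diagonal_transpose _

theorem dg_conjTranspose (j : ℕ) (z : X) : (B.dg j z)ᴴ = B.dg j z := by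
  rw [dg, diagonal_conjTranspose]
  congr 1
  ext w
  exact B.star_idem j z w

theorem dg_mul_comm (i j : ℕ) (y z : X) : B.dg i y * B.dg j z = B.dg j z * B.dg i y := by
  simp [dg, mul_comm]

/-- E_j is symmetric and idempotent, so its (x, y) entry is the inner product of its columns x and
y. This turns a sum over block paths into an element of the Bose–Mesner algebra when M lies there.
-/
theorem sum_dg_mul_dg (j : ℕ) (M : Matrix X X ℂ) :
    ∑ z, B.dg j z * M * B.dg j z = B.idem j ⊙ M := by
  ext x y
  have h : B.idem j x y = ∑ z, B.idem j z x * B.idem j z y := by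
    conv_lhs => rw [← B.idem_mul_self j, Matrix.mul_apply]
    exact Finset.sum_congr rfl fun z _ => by rw [B.idem_symm j x z]
  rw [Matrix.sum_apply, hadamard_apply, h, Finset.sum_mul]
  refine Finset.sum_congr rfl fun z _ => ?_
  rw [dg, mul_diagonal, diagonal_mul]
  ring

theorem sum_smul_dg (j : ℕ) (y : X) : ∑ z, B.idem j y z • B.dg j z = B.dg j y := by
  ext x w
  rw [Matrix.sum_apply]
  by_cases h : x = w
  · subst h
    conv_rhs => rw [dg, diagonal_apply_eq, ← B.idem_mul_self j, Matrix.mul_apply]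
    simp [dg]
  · simp [dg, h]

/-- The triple sum equals the sum over z of the squared Frobenius norms of the blocks, so it
vanishes only if each block does. -/
theorem triple_eq_zero_iff {i j k : ℕ} :
    B.triple i j k = 0 ↔ ∀ z, B.idem i * B.dg j z * B.idem k = 0 := by
  have key : ∑ z, ((B.idem i * B.dg j z * B.idem k) * (B.idem i * B.dg j z * B.idem k)ᴴ).trace
      = B.triple i j k := by
    rw [← B.trace_idem_mul_hadamard, ← B.sum_dg_mul_dg, Finset.mul_sum, trace_sum]
    refine Finset.sum_congr rfl fun z _ => ?_
    rw [conjTranspose_mul, conjTranspose_mul, B.idem_conjTranspose, B.idem_conjTranspose,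
      B.dg_conjTranspose, ← Matrix.mul_assoc, ← Matrix.mul_assoc, trace_mul_comm]
    conv_rhs => rw [← B.idem_mul_self i, ← B.idem_mul_self k]
    simp only [Matrix.mul_assoc]
  constructor
  · intro h z
    rw [h] at key
    have hnn : ∀ z ∈ univ, 0 ≤ ((B.idem i * B.dg j z * B.idem k) *
        (B.idem i * B.dg j z * B.idem k)ᴴ).trace := fun z _ =>
      (posSemidef_self_mul_conjTranspose _).trace_nonneg
    have := (Finset.sum_eq_zero_iff_of_nonneg hnn).mp key z (mem_univ z)
    exact trace_mul_conjTranspose_self_eq_zero_iff.mp this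
  · intro h
    simp [← key, h]

end PrimitiveIdempotents

end SymmAssocScheme

/-! ### Consequences of the Q-polynomial property; the formula for the ratio. -/

namespace SymmAssocScheme

namespace PrimitiveIdempotents

variable {X : Type*} [Fintype X] {d : ℕ} [DecidableEq X]
variable {S : SymmAssocScheme X d} (B : S.PrimitiveIdempotents)

/-- The matrix obtained by applying the polynomial `f` to the entries of `|X| E_1`. -/
noncomputable def polyMat (f : Polynomial ℂ) : Matrix X X ℂ :=
  ∑ h, f.eval (B.q 1 h) • S.A h

theorem polyMat_add (f g : Polynomial ℂ) : B.polyMat (f + g) = B.polyMat f + B.polyMat g := by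
  simp [polyMat, add_smul, Finset.sum_add_distrib]

theorem polyMat_C_mul (c : ℂ) (f : Polynomial ℂ) :
    B.polyMat (Polynomial.C c * f) = c • B.polyMat f := by
  simp [polyMat, Finset.smul_sum, smul_smul]

theorem polyMat_eq_smul_E {v : Polynomial ℂ} {i : Fin (d + 1)}
    (hv : ∀ j, B.q i j = v.eval (B.q 1 j)) : B.polyMat v = (Fintype.card X : ℂ) • B.E i := by
  rw [B.E_eq_sum, smul_inv_smul₀ S.card_ne_zero, polyMat]
  simp only [hv]

variable {B}

theorem IsQPolynomial.exists_poly (hQ : B.IsQPolynomial) {i : ℕ} (hi : i ≤ d) :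
    ∃ v : Polynomial ℂ, v.degree = (i : WithBot ℕ) ∧
      B.polyMat v = (Fintype.card X : ℂ) • B.idem i := by
  obtain ⟨v, h1, h2⟩ := hQ ⟨i, Nat.lt_succ_of_le hi⟩
  exact ⟨v, h1, by rw [B.polyMat_eq_smul_E h2, B.idem_of_le hi]⟩

/-- Since v*_r has degree exactly r, a multiple of it cancels the term of degree r in f. -/
theorem IsQPolynomial.exists_polyMat_eq (hQ : B.IsQPolynomial) {r : ℕ} (hr : r ≤ d)
    {f : Polynomial ℂ} (hf : f.degree ≤ (r : WithBot ℕ)) :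
    ∃ (c : ℂ) (g : Polynomial ℂ), g.degree < (r : WithBot ℕ) ∧
      B.polyMat f = c • B.idem r + B.polyMat g ∧ (f.degree = (r : WithBot ℕ) → c ≠ 0) := by
  obtain ⟨v, hv, hvE⟩ := hQ.exists_poly hr
  have hv0 : v.coeff r ≠ 0 := Polynomial.coeff_ne_zero_of_eq_degree hv
  refine ⟨f.coeff r / v.coeff r * Fintype.card X,
    f + Polynomial.C (-(f.coeff r / v.coeff r)) * v, ?_, ?_, fun h => ?_⟩
  · rw [Polynomial.degree_lt_iff_coeff_zero]
    intro k hk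
    rcases hk.eq_or_lt with rfl | hk
    · rw [Polynomial.coeff_add, Polynomial.coeff_C_mul]
      field_simp
      ring
    · rw [Polynomial.coeff_add, Polynomial.coeff_C_mul,
        Polynomial.coeff_eq_zero_of_degree_lt (hf.trans_lt (by exact_mod_cast hk)),
        Polynomial.coeff_eq_zero_of_degree_lt (p := v) (n := k) (by rw [hv]; exact_mod_cast hk)]
      simp
  · rw [polyMat_add, polyMat_C_mul, hvE]
    module
  · exact mul_ne_zero (div_ne_zero (Polynomial.coeff_ne_zero_of_eq_degree h) hv0) S.card_ne_zero

theorem IsQPolynomial.polyMat_mul_idem_of_degree_lt (hQ : B.IsQPolynomial) (r : ℕ)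
    (hr : r ≤ d + 1) (f : Polynomial ℂ) (hf : f.degree < (r : WithBot ℕ)) (k : ℕ) (hk : r ≤ k) :
    B.polyMat f * B.idem k = 0 := by
  induction r generalizing f with
  | zero =>
    have : f = 0 := by simpa [Polynomial.degree_lt_iff_coeff_zero, Polynomial.ext_iff] using hf
    simp [this, polyMat]
  | succ r ih =>
    obtain ⟨c, g, hg, h, -⟩ := hQ.exists_polyMat_eq (r := r) (by omega)
      (f := f) (Polynomial.degree_le_iff_coeff_zero _ _ |>.mpr fun n hn =>
        (Polynomial.degree_lt_iff_coeff_zero _ _).mp hf n (by exact_mod_cast hn))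
    rw [h, add_mul, ih (by omega) g hg (by omega), smul_mul_assoc,
      B.idem_mul_of_ne (by omega), smul_zero, add_zero]

theorem IsQPolynomial.hadamard_eq_polyMat (hQ : B.IsQPolynomial) {i j : ℕ} (hi : i ≤ d)
    (hj : j ≤ d) : ∃ f : Polynomial ℂ, f.degree = ((i + j : ℕ) : WithBot ℕ) ∧ ∃ c : ℂ, c ≠ 0 ∧
      B.idem i ⊙ B.idem j = c • B.polyMat f := by
  obtain ⟨v, hv, hvE⟩ := hQ.exists_poly hi
  obtain ⟨w, hw, hwE⟩ := hQ.exists_poly hj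
  have hn := S.card_ne_zero
  refine ⟨v * w, by rw [Polynomial.degree_mul, hv, hw]; simp, (Fintype.card X : ℂ)⁻¹ ^ 2,
    pow_ne_zero _ (inv_ne_zero hn), ?_⟩
  rw [← inv_smul_eq_iff₀ hn] at hvE hwE
  rw [← hvE, ← hwE]
  ext x y
  obtain ⟨k, hk⟩ := S.exists_mem x y
  simp only [polyMat, hadamard_apply, Matrix.smul_apply, S.sum_A_apply _ hk, smul_eq_mul,
    Polynomial.eval_mul]
  ring

theorem triple_eq_zero_of_gt (B : S.PrimitiveIdempotents) {i j k : ℕ} (h : d < i ∨ d < j ∨ d < k) :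
    B.triple i j k = 0 := by
  rcases h with h | h | h <;> simp [triple, B.idem_of_lt h]

theorem IsQPolynomial.le_of_triple_ne_zero (hQ : B.IsQPolynomial) {i j k : ℕ}
    (h : B.triple i j k ≠ 0) : k ≤ i + j := by
  by_contra! hk
  by_cases hd : d < i ∨ d < j ∨ d < k
  · exact h (B.triple_eq_zero_of_gt hd)
  push Not at hd
  obtain ⟨f, hf, c, -, hc⟩ := hQ.hadamard_eq_polyMat hd.1 hd.2.1
  obtain ⟨e, he, -, he0⟩ := B.exists_hadamard_mul_idem i j k
  rw [hc, smul_mul_assoc, hQ.polyMat_mul_idem_of_degree_lt (i + j + 1) (by omega) f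
    (by rw [hf]; exact_mod_cast Nat.lt_succ_self _) k (by omega), smul_zero] at he
  exact he0 h ((smul_eq_zero.mp he.symm).resolve_right (B.idem_ne_zero hd.2.2))

theorem IsQPolynomial.triple_add_ne_zero (hQ : B.IsQPolynomial) {i j : ℕ} (h : i + j ≤ d) :
    B.triple i j (i + j) ≠ 0 := by
  obtain ⟨f, hf, c, hc0, hc⟩ := hQ.hadamard_eq_polyMat (i := i) (j := j) (by omega) (by omega)
  obtain ⟨e, g, hg, hfg, he⟩ := hQ.exists_polyMat_eq h hf.le
  have h1 : B.idem (i + j) * (B.idem i ⊙ B.idem j) = (c * e) • B.idem (i + j) := by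
    have h2 : (B.idem i ⊙ B.idem j) * B.idem (i + j) = (c * e) • B.idem (i + j) := by
      rw [hc, hfg, smul_mul_assoc, add_mul, smul_mul_assoc, B.idem_mul_self,
        hQ.polyMat_mul_idem_of_degree_lt (i + j) (by omega) g hg _ le_rfl, add_zero, smul_smul]
    have := congrArg Matrix.transpose h2
    rwa [transpose_mul, transpose_smul, B.idem_transpose,
      S.transpose_eq_of_mem (S.hadamard_mem (B.idem_mem i) (B.idem_mem j))] at this
  rw [B.triple_rotate, ← B.trace_idem_mul_hadamard, h1, trace_smul, smul_eq_mul]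
  exact mul_ne_zero (mul_ne_zero hc0 (he hf)) (B.trace_idem_ne_zero h)

/-- Every q_i is a polynomial in q_1, so if θ*_a = θ*_b then no E_i, and hence no matrix of the
algebra, separates R_a from R_b; but A_a does. -/
theorem IsQPolynomial.dualEigenvalue_injective (hQ : B.IsQPolynomial) :
    Function.Injective B.dualEigenvalue := by
  intro a b hab
  obtain ⟨⟨x, y⟩, hxy⟩ := S.nonempty a
  obtain ⟨⟨x', y'⟩, hxy'⟩ := S.nonempty b
  have hE : ∀ i, B.E i x y = B.E i x' y' := fun i => by
    obtain ⟨v, -, hv⟩ := hQ i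
    rw [B.E_apply hxy, B.E_apply hxy', hv, hv]
    exact congrArg (fun t => _ * v.eval t) hab
  have hA : S.A a x y = S.A a x' y' := by
    simp only [B.A_eq_sum a, Matrix.sum_apply, Matrix.smul_apply, hE]
  rw [S.A_apply hxy, S.A_apply hxy', if_pos rfl] at hA
  by_contra hne
  simp [hne] at hA

/-- The generalized Larman–Rogers–Seidel ratio is an eigenvalue of `-A_j`. -/
theorem IsQPolynomial.K_eq (hQ : B.IsQPolynomial) {j : Fin (d + 1)} (hj : j ≠ 0) :
    B.K j = -B.p j (Fin.last d) := by
  have hd : 1 ≤ d := by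
    rcases Nat.eq_zero_or_pos d with rfl | h
    · exact absurd (Fin.ext (by have := j.2; simp only [Fin.val_zero]; omega)) hj
    · exact h
  set s : Finset (Fin (d + 1)) := univ.filter fun k => k ≠ 0 ∧ k ≠ j with hs
  set f : Polynomial ℂ := ∏ k ∈ s, (Polynomial.X - Polynomial.C (B.dualEigenvalue k)) with hf
  have hcard : s.card = d - 1 := by
    have : s = (univ.erase 0).erase j := by ext; simp [hs, and_comm]
    rw [this, card_erase_of_mem (by simpa using hj), card_erase_of_mem (mem_univ _)]
    simp
  have heval : ∀ k, f.eval (B.q 1 k) = ∏ i ∈ s, (B.dualEigenvalue k - B.dualEigenvalue i) := by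
    intro k
    simp [hf, Polynomial.eval_prod, dualEigenvalue]
  have hdeg : f.degree < (d : WithBot ℕ) := by
    rw [hf, Polynomial.degree_prod]
    simp only [Polynomial.degree_X_sub_C, sum_const, hcard, nsmul_eq_mul, mul_one]
    exact_mod_cast Nat.sub_lt hd one_pos
  -- Degree d - 1 means annihilation by E_d, while the roots of `f` leave only the terms in A_0 = I
  -- and A_j.
  have hzero := hQ.polyMat_mul_idem_of_degree_lt d (by omega) f hdeg d le_rfl
  have hmat : B.polyMat f = f.eval (B.q 1 0) • S.A 0 + f.eval (B.q 1 j) • S.A j := by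
    rw [polyMat, Finset.sum_eq_add 0 j hj.symm]
    · intro k _ hk
      rw [heval, Finset.prod_eq_zero (i := k) (by simpa [hs] using hk) (sub_self _), zero_smul]
    · simp
    · simp
  have hlast : B.idem d = B.E (Fin.last d) := B.idem_of_le le_rfl
  rw [hmat, hlast, add_mul, S.A_zero, smul_mul_assoc, smul_mul_assoc, one_mul, B.A_mul_E, smul_smul,
    ← add_smul, heval, heval] at hzero
  have h0 := (smul_eq_zero.mp hzero).resolve_right (B.E_ne_zero _)
  have hne : ∏ i ∈ s, (B.dualEigenvalue j - B.dualEigenvalue i) ≠ 0 := by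
    refine Finset.prod_ne_zero_iff.mpr fun i hi => sub_ne_zero.mpr fun h => ?_
    exact (Finset.mem_filter.mp hi).2.2 (hQ.dualEigenvalue_injective h).symm
  rw [K, Finset.prod_div_distrib, div_eq_iff hne]
  linear_combination h0

end PrimitiveIdempotents

end SymmAssocScheme

/-! ### Paths of blocks, and the vanishing of q_{11}^1. -/

namespace SymmAssocScheme

namespace PrimitiveIdempotents

variable {X : Type*} [Fintype X] {d : ℕ} [DecidableEq X]
variable {S : SymmAssocScheme X d} (B : S.PrimitiveIdempotents)

theorem idem_mul_dg_mul_idem {i j k : ℕ} (h : B.triple i j k = 0) (z : X) :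
    B.idem i * (B.dg j z * B.idem k) = 0 := by
  rw [← Matrix.mul_assoc]
  exact B.triple_eq_zero_iff.mp h z

theorem triple_swap_right (i j k : ℕ) : B.triple i j k = B.triple i k j := by
  rw [B.triple_rotate, B.triple_swap]

theorem sum_mul_dg_mul_dg (j : ℕ) (L M N : Matrix X X ℂ) :
    ∑ z, L * (B.dg j z * (M * (B.dg j z * N))) = L * ((B.idem j ⊙ M) * N) := by
  rw [← B.sum_dg_mul_dg, Finset.sum_mul, Finset.mul_sum]
  simp only [Matrix.mul_assoc]

theorem idem_zero_apply (x y : X) : B.idem 0 x y = (Fintype.card X : ℂ)⁻¹ := by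
  have h : B.idem 0 = B.E 0 := B.idem_of_le (Nat.zero_le d)
  simp [h, B.zero_eq]

theorem idem_dg_dg_idem_eq_sum (i k : ℕ) (x y : X) :
    B.idem i * (B.dg 1 x * (B.dg 1 y * B.idem k)) =
      ∑ l ∈ range (d + 1), B.idem i * (B.dg 1 x * (B.idem l * (B.dg 1 y * B.idem k))) := by
  simp only [← Finset.mul_sum, ← Finset.sum_mul, B.sum_idem, one_mul]

/-- Inserting I = ∑ E_l between the two multipliers sums over all intermediate spaces; only one of
them survives. -/
theorem idem_dg_dg_idem_eq_single {i k l : ℕ} (hl : l ≤ d)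
    (h : ∀ l', l' ≠ l → B.triple i 1 l' = 0 ∨ B.triple l' 1 k = 0) (x y : X) :
    B.idem i * (B.dg 1 x * (B.dg 1 y * B.idem k)) =
      B.idem i * (B.dg 1 x * (B.idem l * (B.dg 1 y * B.idem k))) := by
  rw [idem_dg_dg_idem_eq_sum, Finset.sum_eq_single l]
  · intro l' _ hne
    rcases h l' hne with h0 | h0
    · rw [← Matrix.mul_assoc (B.dg 1 x), ← Matrix.mul_assoc, B.idem_mul_dg_mul_idem h0, zero_mul]
    · rw [B.idem_mul_dg_mul_idem h0, mul_zero, mul_zero]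
  · intro hl'
    exact absurd (mem_range.mpr (Nat.lt_succ_of_le hl)) hl'

theorem idem_dg_dg_idem_eq_add {i k l₁ l₂ : ℕ} (h₁ : l₁ ≤ d) (h₂ : l₂ ≤ d) (hne : l₁ ≠ l₂)
    (h : ∀ l', l' ≠ l₁ → l' ≠ l₂ → B.triple i 1 l' = 0) (x y : X) :
    B.idem i * (B.dg 1 x * (B.dg 1 y * B.idem k)) =
      B.idem i * (B.dg 1 x * (B.idem l₁ * (B.dg 1 y * B.idem k))) +
      B.idem i * (B.dg 1 x * (B.idem l₂ * (B.dg 1 y * B.idem k))) := by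
  rw [idem_dg_dg_idem_eq_sum, Finset.sum_eq_add l₁ l₂ hne]
  · rintro l' _ ⟨h1, h2⟩
    rw [← Matrix.mul_assoc (B.dg 1 x), ← Matrix.mul_assoc, B.idem_mul_dg_mul_idem (h l' h1 h2),
      zero_mul]
  · intro hl'
    exact absurd (mem_range.mpr (Nat.lt_succ_of_le h₁)) hl'
  · intro hl'
    exact absurd (mem_range.mpr (Nat.lt_succ_of_le h₂)) hl'

theorem dg_mul_dg_eq_sum (x y : X) : B.dg 1 x * B.dg 1 y =
    ∑ l ∈ range (d + 1), ∑ z, (B.idem 1 x z * B.idem 1 y z) • B.dg l z := by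
  have h : ∀ a : X, B.idem 1 x a * B.idem 1 y a =
      ∑ l ∈ range (d + 1), ∑ z, (B.idem 1 x z * B.idem 1 y z) * B.idem l z a := by
    intro a
    rw [Finset.sum_comm]
    simp_rw [← Finset.mul_sum, ← Matrix.sum_apply, B.sum_idem]
    simp [Matrix.one_apply]
  ext a b
  by_cases hab : a = b
  · subst hab
    simp [dg, Matrix.sum_apply, h a]
  · simp [dg, Matrix.sum_apply, hab]

/-- If the only component of `V_1 ∘ V_1` that couples `V_i` to `V_k` is the constant one, then the
corresponding block of a product of two elements of `V_1` is a scalar. -/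
theorem idem_dg_dg_idem_eq_smul {i k : ℕ}
    (h : ∀ l, l ≠ 0 → B.triple 1 1 l = 0 ∨ B.triple i l k = 0) (x y : X) :
    B.idem i * (B.dg 1 x * (B.dg 1 y * B.idem k)) =
      ((Fintype.card X : ℂ)⁻¹ * B.idem 1 x y) • (B.idem i * B.idem k) := by
  -- This is the V_l-component of the pointwise product of rows x and y of E_1. For l = 0 it is the
  -- constant given by their inner product divided by |X|.
  have hz : ∀ l, B.triple 1 1 l = 0 → ∑ z, (B.idem 1 x z * B.idem 1 y z) • B.dg l z = 0 := by
    intro l hl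
    ext a b
    by_cases hab : a = b
    · subst hab
      have h1 := congrFun (congrFun (B.triple_eq_zero_iff.mp
        ((B.triple_swap_right 1 l 1).trans hl) a) x) y
      rw [Matrix.mul_apply] at h1
      simp only [dg, mul_diagonal, Matrix.zero_apply] at h1
      simp only [Matrix.sum_apply, Matrix.smul_apply, dg, diagonal_apply_eq, smul_eq_mul,
        Matrix.zero_apply]
      rw [← h1]
      refine Finset.sum_congr rfl fun z _ => ?_
      rw [B.idem_symm l z a, B.idem_symm 1 y z]
      ring
    · simp [dg, Matrix.sum_apply, hab]
  have h0 : ∑ z, (B.idem 1 x z * B.idem 1 y z) • B.dg 0 z =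
      ((Fintype.card X : ℂ)⁻¹ * B.idem 1 x y) • (1 : Matrix X X ℂ) := by
    have h2 : ∀ z, B.dg 0 z = (Fintype.card X : ℂ)⁻¹ • (1 : Matrix X X ℂ) := fun z => by
      rw [dg, Matrix.smul_one_eq_diagonal]
      congr 1
      ext w
      exact B.idem_zero_apply z w
    simp_rw [h2, smul_smul, ← Finset.sum_smul, ← Finset.sum_mul]
    congr 1
    conv_rhs => rw [← B.idem_mul_self 1, Matrix.mul_apply]
    rw [mul_comm]
    simp_rw [B.idem_symm 1 y]
  rw [← Matrix.mul_assoc (B.dg 1 x), B.dg_mul_dg_eq_sum, Finset.sum_mul, Finset.mul_sum,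
    Finset.sum_eq_single 0, h0, smul_mul_assoc, mul_smul_comm, one_mul]
  · intro l _ hl
    rcases h l hl with h1 | h1
    · rw [hz l h1, zero_mul, mul_zero]
    · simp only [Finset.sum_mul, Finset.mul_sum, smul_mul_assoc, mul_smul_comm,
        B.idem_mul_dg_mul_idem h1, smul_zero, Finset.sum_const_zero]
  · simp

variable {B}

theorem IsQPolynomial.triple_eq_zero (hQ : B.IsQPolynomial) {i j k : ℕ}
    (h : i + j < k ∨ j + k < i ∨ k + i < j) : B.triple i j k = 0 := by
  by_contra h0
  have h1 := hQ.le_of_triple_ne_zero h0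
  have h2 := hQ.le_of_triple_ne_zero (B.triple_rotate i j k ▸ h0)
  have h3 := hQ.le_of_triple_ne_zero (B.triple_rotate k i j ▸ B.triple_rotate i j k ▸ h0)
  omega

theorem IsQPolynomial.triple_ne_zero (hQ : B.IsQPolynomial) {i j k : ℕ}
    (hi : i ≤ d) (hj : j ≤ d) (hk : k ≤ d) (h : i + j = k ∨ j + k = i ∨ k + i = j) :
    B.triple i j k ≠ 0 := by
  rcases h with rfl | rfl | rfl
  · exact hQ.triple_add_ne_zero hk
  · rw [B.triple_rotate, B.triple_rotate]
    exact hQ.triple_add_ne_zero hi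
  · rw [B.triple_rotate]
    exact hQ.triple_add_ne_zero hj

/-- If `q_{1i}^i = 0` for some `1 ≤ i < d`, then `q_{11}^1 = 0`. -/
theorem IsQPolynomial.triple_one_one_one_eq_zero (hQ : B.IsQPolynomial) {r : ℕ} (hr : r + 2 ≤ d)
    (h : B.triple 1 (r + 1) (r + 1) = 0) : B.triple 1 1 1 = 0 := by
  by_contra h111
  have h' : B.triple (r + 1) 1 (r + 1) = 0 := B.triple_swap _ _ _ ▸ h
  -- Two-step paths between levels r + 1 and r + 2 could pass through either level, but the
  -- vanishing of q_{1,r+1}^{r+1} excludes r + 1. Paths between r and r + 2 pass only through r + 1.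
  -- Uniqueness of the path lets the two multipliers be swapped.
  have c1 : ∀ u v, B.idem (r + 2) * (B.dg 1 u * (B.idem (r + 2) * (B.dg 1 v * B.idem (r + 1)))) =
      B.idem (r + 2) * (B.dg 1 u * (B.dg 1 v * B.idem (r + 1))) := fun u v => by
    refine (B.idem_dg_dg_idem_eq_single hr (fun l hl => ?_) u v).symm
    by_cases hl1 : l = r + 1
    · subst hl1; exact Or.inr h'
    by_cases hl2 : l < r + 1
    · exact Or.inl (hQ.triple_eq_zero (by omega))
    · exact Or.inr (hQ.triple_eq_zero (by omega))
  have c2 : ∀ u v, B.idem (r + 2) * (B.dg 1 u * (B.idem (r + 1) * (B.dg 1 v * B.idem r))) =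
      B.idem (r + 2) * (B.dg 1 u * (B.dg 1 v * B.idem r)) := fun u v => by
    refine (B.idem_dg_dg_idem_eq_single (by omega) (fun l hl => ?_) u v).symm
    by_cases hl2 : l < r + 1
    · exact Or.inl (hQ.triple_eq_zero (by omega))
    · exact Or.inr (hQ.triple_eq_zero (by omega))
  have comm : ∀ u v M, B.dg 1 u * (B.dg 1 v * M) = B.dg 1 v * (B.dg 1 u * M) := fun u v M => by
    rw [← Matrix.mul_assoc, B.dg_mul_comm, Matrix.mul_assoc]
  have s1 : ∀ u v M,
      B.idem (r + 2) * (B.dg 1 u * (B.idem (r + 2) * (B.dg 1 v * (B.idem (r + 1) * M)))) =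
      B.idem (r + 2) * (B.dg 1 v * (B.idem (r + 2) * (B.dg 1 u * (B.idem (r + 1) * M)))) := by
    intro u v M
    have := congrArg (· * M) ((c1 u v).trans ((congrArg _ (comm u v _)).trans (c1 v u).symm))
    simpa only [Matrix.mul_assoc] using this
  have s2 : ∀ u v, B.idem (r + 2) * (B.dg 1 u * (B.idem (r + 1) * (B.dg 1 v * B.idem r))) =
      B.idem (r + 2) * (B.dg 1 v * (B.idem (r + 1) * (B.dg 1 u * B.idem r))) := fun u v =>
    (c2 u v).trans ((congrArg _ (comm u v _)).trans (c2 v u).symm)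
  obtain ⟨c, -, hc, hc0⟩ := B.exists_hadamard_mul_idem 1 1 1
  replace hc0 := hc0 h111
  -- The assumption q_{11}^1 ≠ 0 makes every element of V_1 a combination of squares of elements of
  -- V_1.
  have hW : ∀ z', c • B.dg 1 z' = ∑ z, B.idem 1 z' z • (B.dg 1 z * B.dg 1 z) := by
    intro z'
    ext a b
    by_cases hab : a = b
    · subst hab
      have := congrFun (congrFun hc z') a
      simp only [Matrix.mul_apply, hadamard_apply, Matrix.smul_apply] at this
      simp [dg, Matrix.sum_apply, this]
    · simp [dg, Matrix.sum_apply, hab]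
  have hW' : ∀ M N z', c • (M * (B.dg 1 z' * N)) =
      ∑ z, B.idem 1 z' z • (M * (B.dg 1 z * (B.dg 1 z * N))) := fun M N z' => by
    rw [← mul_smul_comm, ← smul_mul_assoc, hW, Finset.sum_mul, Finset.mul_sum]
    simp only [smul_mul_assoc, mul_smul_comm, Matrix.mul_assoc]
  -- Replace z' by squares and move y to the far left by the swaps. The squares recombine into a
  -- direct block from V_r to V_{r+2}, which is zero by the triangle inequality.
  have key : ∀ z' y, B.idem (r + 2) * (B.dg 1 z' * (B.idem (r + 1) * (B.dg 1 y * B.idem r))) = 0 := by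
    intro z' y
    have hterm : ∀ z, B.idem (r + 2) *
        (B.dg 1 z * (B.dg 1 z * (B.idem (r + 1) * (B.dg 1 y * B.idem r)))) =
        B.idem (r + 2) * (B.dg 1 y * (B.idem (r + 2) * (B.dg 1 z * (B.dg 1 z * B.idem r)))) := by
      intro z
      have e1 := congrArg (· * (B.dg 1 y * B.idem r)) (c1 z z)
      simp only [Matrix.mul_assoc] at e1
      rw [← e1, s2 z y, s1 z y, c2 z z]
    have h5 : c • (B.idem (r + 2) * (B.dg 1 z' * (B.idem (r + 1) * (B.dg 1 y * B.idem r)))) =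
        B.idem (r + 2) * (B.dg 1 y * (c • (B.idem (r + 2) * (B.dg 1 z' * B.idem r)))) := by
      simp only [hW', hterm, Finset.mul_sum, mul_smul_comm]
    rw [B.idem_mul_dg_mul_idem (i := r + 2) (k := r) (hQ.triple_eq_zero (by omega)), smul_zero,
      mul_zero, mul_zero] at h5
    exact (smul_eq_zero.mp h5).resolve_left hc0
  obtain ⟨e, he, -, he0⟩ := B.exists_hadamard_mul_idem 1 r (r + 1)
  replace he0 := he0 (hQ.triple_ne_zero (by omega) (by omega) (by omega) (by omega))
  have h3 : B.triple (r + 2) 1 (r + 1) ≠ 0 :=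
    hQ.triple_ne_zero (by omega) (by omega) (by omega) (by omega)
  refine h3 (B.triple_eq_zero_iff.mpr fun z => ?_)
  have h4 := B.sum_mul_dg_mul_dg 1 (B.idem (r + 2) * B.dg 1 z * B.idem (r + 1)) (B.idem r)
    (B.idem (r + 1))
  rw [Finset.sum_eq_zero, he, mul_smul_comm, eq_comm, Matrix.mul_assoc, B.idem_mul_self] at h4
  · exact (smul_eq_zero.mp h4).resolve_left he0
  · intro y _
    have := congrArg (· * (B.dg 1 y * B.idem (r + 1))) (key z y)
    simpa only [Matrix.mul_assoc, zero_mul] using this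

end PrimitiveIdempotents

end SymmAssocScheme

/-! ### Nonvanishing of q_{22}^3 and q_{2a}^a. -/

namespace SymmAssocScheme

namespace PrimitiveIdempotents

variable {X : Type*} [Fintype X] {d : ℕ} [DecidableEq X]
variable {S : SymmAssocScheme X d} {B : S.PrimitiveIdempotents}

/-- Otherwise only the constant part of a product of two elements of V_1 could act from V_2 to V_3,
and it acts as zero. Closing up a path through V_2, where q_{12}^2 ≠ 0, would then give q_{12}^3 =
0. -/
theorem IsQPolynomial.triple_two_two_three_ne_zero (hQ : B.IsQPolynomial) (hd : 3 ≤ d)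
    (h1 : B.triple 1 1 1 = 0) (h2 : B.triple 1 2 2 ≠ 0) : B.triple 2 2 3 ≠ 0 := by
  intro h3
  have h0 : ∀ x y, B.idem 3 * (B.dg 1 x * (B.dg 1 y * B.idem 2)) = 0 := fun x y => by
    rw [B.idem_dg_dg_idem_eq_smul (fun l hl => ?_), B.idem_mul_of_ne (by omega), smul_zero]
    rcases (by omega : l = 1 ∨ l = 2 ∨ 2 < l) with rfl | rfl | hl
    · exact Or.inl h1
    · exact Or.inr (B.triple_rotate 2 2 3 ▸ h3)
    · exact Or.inl (hQ.triple_eq_zero (by omega))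
  obtain ⟨c, hc, -, hc0⟩ := B.exists_hadamard_mul_idem 1 2 2
  replace hc0 := hc0 h2
  have h4 : B.triple 3 1 2 ≠ 0 := hQ.triple_ne_zero (by omega) (by omega) (by omega) (by omega)
  refine h4 (B.triple_eq_zero_iff.mpr fun z => ?_)
  have h5 := B.sum_mul_dg_mul_dg 1 (B.idem 3 * B.dg 1 z) (B.idem 2) (B.idem 2)
  rw [Finset.sum_eq_zero, hc, mul_smul_comm, eq_comm] at h5
  · exact (smul_eq_zero.mp h5).resolve_left hc0
  · intro y _
    have := congrArg (· * (B.dg 1 y * B.idem 2)) (h0 z y)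
    simpa only [Matrix.mul_assoc, zero_mul] using this

/-- The product of two elements of `V_1`, restricted to `V_i` and factored through `V_l`. -/
noncomputable def via (B : S.PrimitiveIdempotents) (i l : ℕ) (x y : X) : Matrix X X ℂ :=
  B.idem i * (B.dg 1 x * (B.idem l * (B.dg 1 y * B.idem i)))

theorem idem_mul_via (i l : ℕ) (x y : X) : B.idem i * B.via i l x y = B.via i l x y := by
  rw [via, ← Matrix.mul_assoc, B.idem_mul_self]

theorem via_mul_idem (i l : ℕ) (x y : X) : B.via i l x y * B.idem i = B.via i l x y := by
  simp only [via, Matrix.mul_assoc, B.idem_mul_self]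

theorem via_transpose (i l : ℕ) (x y : X) : (B.via i l x y)ᵀ = B.via i l y x := by
  simp only [via, transpose_mul, B.idem_transpose, B.dg_transpose, Matrix.mul_assoc]

theorem sum_smul_via_left (i l : ℕ) (x y : X) :
    ∑ v, B.idem 1 v x • B.via i l v y = B.via i l x y := by
  conv_rhs => rw [via, ← B.sum_smul_dg 1 x, Finset.sum_mul, Finset.mul_sum]
  refine Finset.sum_congr rfl fun v _ => ?_
  rw [via, B.idem_symm 1 v x, smul_mul_assoc, mul_smul_comm]

theorem sum_smul_via_right (i l : ℕ) (x y : X) :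
    ∑ v, B.idem 1 y v • B.via i l x v = B.via i l x y := by
  conv_rhs => rw [via, ← B.sum_smul_dg 1 y]
  simp only [Finset.sum_mul, Finset.mul_sum, smul_mul_assoc, mul_smul_comm, via]

theorem exists_sum_via_self (i l : ℕ) :
    ∃ c : ℂ, ∑ v, B.via i l v v = c • B.idem i ∧ (B.triple 1 l i ≠ 0 → c ≠ 0) := by
  obtain ⟨c, hc, -, hc0⟩ := B.exists_hadamard_mul_idem 1 l i
  refine ⟨c, ?_, hc0⟩
  simp only [via]
  rw [B.sum_mul_dg_mul_dg, hc, mul_smul_comm, B.idem_mul_self]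

/-- Summation over u leaves E_l (E_1 ∘ E_i) E_{l'} in the middle, which vanishes by commutativity of
the Bose–Mesner algebra. -/
theorem sum_via_mul_via {i l l' : ℕ} (h : l ≠ l') (w z : X) :
    ∑ u, B.via i l w u * B.via i l' u z = 0 := by
  have h1 : ∀ u, B.via i l w u * B.via i l' u z =
      (B.idem i * B.dg 1 w * B.idem l) * (B.dg 1 u * (B.idem i * (B.dg 1 u *
        (B.idem l' * (B.dg 1 z * B.idem i))))) := fun u => by
    have h2 : ∀ M, B.idem i * (B.idem i * M) = B.idem i * M := fun M => by
      rw [← Matrix.mul_assoc, B.idem_mul_self]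
    simp only [via, Matrix.mul_assoc, h2]
  simp only [h1]
  rw [B.sum_mul_dg_mul_dg]
  have h3 := B.idem_mul_mul_idem_of_ne (S.hadamard_mem (B.idem_mem 1) (B.idem_mem i)) h
  have h4 : (B.idem i * B.dg 1 w * B.idem l) * ((B.idem 1 ⊙ B.idem i) *
      (B.idem l' * (B.dg 1 z * B.idem i))) = (B.idem i * B.dg 1 w) *
      (B.idem l * (B.idem 1 ⊙ B.idem i) * B.idem l') * (B.dg 1 z * B.idem i) := by
    simp only [Matrix.mul_assoc]
  rw [h4, h3, mul_zero, zero_mul]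

theorem sum_idem_self (i : ℕ) : ∑ v, B.idem i v v = (B.idem i).trace := rfl

/-- If `q_{11}^1 = 0` and `q_{1a}^a = 0` for some `1 ≤ a < d`, then `q_{2a}^a ≠ 0`, provided that
`m_1 ≠ 2`. -/
theorem IsQPolynomial.triple_two_ne_zero (hQ : B.IsQPolynomial) (hm : (B.idem 1).trace ≠ 2)
    {r : ℕ} (hr : r + 2 ≤ d) (h1 : B.triple 1 1 1 = 0) (ha : B.triple 1 (r + 1) (r + 1) = 0) :
    B.triple 2 (r + 1) (r + 1) ≠ 0 := by
  intro h2
  have hm0 : (B.idem 1).trace ≠ 0 := B.trace_idem_ne_zero (by omega)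
  have hP := B.idem_ne_zero (i := r + 1) (by omega)
  set n := (Fintype.card X : ℂ) with hn
  have hn0 : n ≠ 0 := S.card_ne_zero
  set m := (B.idem 1).trace with hmdef
  set P := B.idem (r + 1) with hPdef
  set U := B.via (r + 1) r with hU
  set Y := B.via (r + 1) (r + 2) with hY
  -- If q_{2a}^a = 0, with a = r + 1, the product of two elements of V_1 acts on V_a as a scalar.
  -- Its paths pass below (`U`) or above (`Y`) level a, since q_{1a}^a = 0.
  have hUY : ∀ x y, U x y + Y x y = (n⁻¹ * B.idem 1 x y) • P := by
    intro x y
    rw [hU, hY, via, via, ← B.idem_dg_dg_idem_eq_add (by omega) hr (by omega),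
      B.idem_dg_dg_idem_eq_smul, B.idem_mul_self]
    · intro l hl
      rcases (by omega : l = 1 ∨ l = 2 ∨ 2 < l) with rfl | rfl | hl
      · exact Or.inl h1
      · exact Or.inr (B.triple_swap 2 _ _ ▸ h2)
      · exact Or.inl (hQ.triple_eq_zero (by omega))
    · intro l h1 h2
      by_cases hl : l = r + 1
      · subst hl; rw [B.triple_swap]; exact ha
      · exact hQ.triple_eq_zero (by omega)
  have hYe : ∀ x y, Y x y = (n⁻¹ * B.idem 1 x y) • P - U x y := fun x y =>
    eq_sub_of_add_eq' (hUY x y)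
  have hswap : ∀ u v, B.idem (r + 2) * (B.dg 1 v * (P * (B.dg 1 u * B.idem r))) =
      B.idem (r + 2) * (B.dg 1 u * (P * (B.dg 1 v * B.idem r))) := by
    have hc : ∀ u v, B.idem (r + 2) * (B.dg 1 v * (B.dg 1 u * B.idem r)) =
        B.idem (r + 2) * (B.dg 1 v * (P * (B.dg 1 u * B.idem r))) := fun u v => by
      refine B.idem_dg_dg_idem_eq_single (by omega) (fun l hl => ?_) v u
      by_cases hl2 : l < r + 1
      · exact Or.inl (hQ.triple_eq_zero (by omega))
      · exact Or.inr (hQ.triple_eq_zero (by omega))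
    intro u v
    rw [← hc, ← hc, ← Matrix.mul_assoc (B.dg 1 v), B.dg_mul_comm, Matrix.mul_assoc]
  -- The inner two multipliers climb from r to r + 2 along the unique path through a, so they can be
  -- exchanged.
  have hYU : ∀ w v u z, Y w v * U u z = Y w u * U v z := by
    have hform : ∀ w v u z, Y w v * U u z = P * (B.dg 1 w * ((B.idem (r + 2) * (B.dg 1 v *
        (P * (B.dg 1 u * B.idem r)))) * (B.dg 1 z * P))) := fun w v u z => by
      have h2 : ∀ M, P * (P * M) = P * M := fun M => by
        rw [← Matrix.mul_assoc, B.idem_mul_self]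
      simp only [hY, hU, via, Matrix.mul_assoc, ← hPdef, h2]
    intro w v u z
    rw [hform, hform, hswap]
  have hU3 : ∀ w v u z, (n⁻¹ * B.idem 1 w v) • U u z - U w v * U u z =
      (n⁻¹ * B.idem 1 w u) • U v z - U w u * U v z := by
    intro w v u z
    have := hYU w v u z
    simpa only [hYe, sub_mul, smul_mul_assoc, hU, hPdef, idem_mul_via] using this
  obtain ⟨κ, hκ, hκ0⟩ := exists_sum_via_self (B := B) (r + 1) r
  replace hκ0 := hκ0 (hQ.triple_ne_zero (by omega) (by omega) (by omega) (by omega))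
  obtain ⟨κ', hκ', hκ0'⟩ := exists_sum_via_self (B := B) (r + 1) (r + 2)
  replace hκ0' := hκ0' (hQ.triple_ne_zero (by omega) (by omega) (by omega) (by omega))
  have hZ : ∀ u z, ∑ v, U v u * U v z = (n⁻¹ - n⁻¹ * m + κ) • U u z := by
    intro u z
    have h := Finset.sum_congr rfl fun v (_ : v ∈ univ) => hU3 v v u z
    rw [Finset.sum_sub_distrib, Finset.sum_sub_distrib, ← Finset.sum_smul, ← Finset.mul_sum,
      ← Finset.sum_mul, hκ, smul_mul_assoc, hU, idem_mul_via] at h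
    simp only [mul_smul, ← Finset.smul_sum] at h
    rw [sum_smul_via_left, sum_idem_self, ← hmdef, ← hU] at h
    linear_combination (norm := module) h
  have hZ' : ∀ w v, ∑ u, U w u * U v u = (n⁻¹ - n⁻¹ * m + κ) • U w v := by
    intro w v
    have := congrArg Matrix.transpose (hZ v w)
    simpa only [transpose_sum, transpose_mul, transpose_smul, hU, via_transpose] using this
  -- Contract `hU3` at z = u; the terms κ • `U w v` cancel. Antisymmetrizing the result in w and v
  -- leaves the factor m - 2, which is where m_1 ≠ 2 enters.
  have hmain : ∀ w v, (κ * (n⁻¹ * B.idem 1 w v)) • P =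
      n⁻¹ • U v w + (n⁻¹ * (m - 1)) • U w v := by
    intro w v
    have h := Finset.sum_congr rfl fun u (_ : u ∈ univ) => hU3 w v u u
    rw [Finset.sum_sub_distrib, Finset.sum_sub_distrib, hZ', ← Finset.smul_sum, ← Finset.mul_sum,
      hκ, mul_smul_comm, hU, via_mul_idem] at h
    simp only [mul_smul, ← Finset.smul_sum] at h
    rw [sum_smul_via_right, ← hU] at h
    simp only [← mul_smul] at h
    linear_combination (norm := module) h
  have hsymm : ∀ w v, U w v = U v w := by
    intro w v
    have h := hmain w v
    have h' := hmain v w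
    rw [B.idem_symm 1 v w] at h'
    have h0 : (n⁻¹ * (m - 2)) • (U w v - U v w) = 0 := by
      linear_combination (norm := module) h' - h
    exact sub_eq_zero.mp ((smul_eq_zero.mp h0).resolve_left
      (mul_ne_zero (inv_ne_zero hn0) (sub_ne_zero.mpr hm)))
  have hUs : ∀ w v, U w v = (κ / m * B.idem 1 w v) • P := by
    intro w v
    have h := hmain w v
    rw [← hsymm w v] at h
    have h0 : U w v = (n * m⁻¹) • ((n⁻¹ * m) • U w v) := by
      rw [smul_smul, show n * m⁻¹ * (n⁻¹ * m) = 1 by field_simp, one_smul]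
    have h3 : (n⁻¹ * m) • U w v = (κ * (n⁻¹ * B.idem 1 w v)) • P := by
      linear_combination (norm := module) -h
    rw [h0, h3, smul_smul]
    congr 1
    field_simp
  have hYs : ∀ w v, Y w v = ((n⁻¹ - κ / m) * B.idem 1 w v) • P := by
    intro w v
    rw [hYe, hUs]
    module
  -- `U` and `Y` are now both scalar multiples of `P`, yet orthogonal by `sum_via_mul_via`. So one
  -- of them vanishes, against κ, κ' ≠ 0.
  have hprod : κ / m * (n⁻¹ - κ / m) = 0 := by
    have h : ∀ w, (κ / m * (n⁻¹ - κ / m) * B.idem 1 w w) • P = 0 := by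
      intro w
      rw [← sum_via_mul_via (B := B) (i := r + 1) (show r ≠ r + 2 by omega) w w, ← hU, ← hY]
      simp only [hUs, hYs, smul_mul_assoc, mul_smul_comm, smul_smul, hPdef, B.idem_mul_self]
      rw [← Finset.sum_smul]
      congr 1
      conv_lhs => rw [← B.idem_mul_self 1, Matrix.mul_apply, Finset.mul_sum]
      exact Finset.sum_congr rfl fun u _ => by ring
    have h3 : ∑ w, κ / m * (n⁻¹ - κ / m) * B.idem 1 w w = 0 :=
      Finset.sum_eq_zero fun w _ => (smul_eq_zero.mp (h w)).resolve_right hP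
    rw [← Finset.mul_sum, sum_idem_self] at h3
    exact (mul_eq_zero.mp h3).resolve_right hm0
  rcases mul_eq_zero.mp hprod with h | h
  · exact div_ne_zero hκ0 hm0 h
  · rw [← hY] at hκ'
    simp only [hYs, h, zero_mul, zero_smul, Finset.sum_const_zero] at hκ'
    exact (smul_ne_zero hκ0' hP) hκ'.symm

end PrimitiveIdempotents

end SymmAssocScheme

/-! ### Combinatorics of permutations preserving a Krein pattern. -/

/-- The ternary relation `N i j k` on `{0, …, d}` has the properties of the relation
`q_{ij}^k ≠ 0` of a `Q`-polynomial scheme with `m_1 ≠ 2`. -/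
structure IsKreinPattern (d : ℕ) (N : ℕ → ℕ → ℕ → Prop) : Prop where
  swap : ∀ {i j k}, N i j k → N j i k
  rotate : ∀ {i j k}, N i j k → N k i j
  le_add : ∀ {i j k}, N i j k → k ≤ i + j
  add : ∀ {i j}, i + j ≤ d → N i j (i + j)
  not_one : ∀ {i}, 1 ≤ i → i < d → ¬N 1 i i → ¬N 1 1 1
  two : ∀ {i}, 1 ≤ i → i < d → ¬N 1 1 1 → ¬N 1 i i → N 2 i i
  three : 3 ≤ d → ¬N 1 1 1 → N 1 2 2 → N 2 2 3

/-- A permutation of `{0, …, d}` with inverse `ρ` that preserves a Krein pattern. -/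
structure IsKreinPattern.Aut {d : ℕ} {N : ℕ → ℕ → ℕ → Prop} (hN : IsKreinPattern d N)
    (π ρ : ℕ → ℕ) : Prop where
  le : ∀ {i}, i ≤ d → π i ≤ d
  le_symm : ∀ {i}, i ≤ d → ρ i ≤ d
  left_inv : ∀ {i}, i ≤ d → ρ (π i) = i
  right_inv : ∀ {i}, i ≤ d → π (ρ i) = i
  zero : π 0 = 0
  map : ∀ {i j k}, i ≤ d → j ≤ d → k ≤ d → N i j k → N (π i) (π j) (π k)
  map_symm : ∀ {i j k}, i ≤ d → j ≤ d → k ≤ d → N i j k → N (ρ i) (ρ j) (ρ k)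

namespace IsKreinPattern

variable {d : ℕ} {N : ℕ → ℕ → ℕ → Prop}

theorem triangle (hN : IsKreinPattern d N) {i j k : ℕ} (h : N i j k) : k ≤ i + j ∧ i ≤ j + k ∧ j ≤ k + i :=
  ⟨hN.le_add h, hN.le_add (hN.rotate (hN.rotate h)), hN.le_add (hN.rotate h)⟩

theorem of_add (hN : IsKreinPattern d N) {i j k : ℕ} (hi : i ≤ d) (hj : j ≤ d) (hk : k ≤ d)
    (h : i + j = k ∨ j + k = i ∨ k + i = j) : N i j k := by
  rcases h with rfl | rfl | rfl
  · exact hN.add hk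
  · exact hN.rotate (hN.add hi)
  · exact hN.rotate (hN.rotate (hN.add hj))

namespace Aut

variable {hN : IsKreinPattern d N} {π ρ : ℕ → ℕ}

theorem symm (h : hN.Aut π ρ) : hN.Aut ρ π where
  le := h.le_symm
  le_symm := h.le
  left_inv := h.right_inv
  right_inv := h.left_inv
  zero := by simpa [h.zero] using h.left_inv (Nat.zero_le d)
  map := h.map_symm
  map_symm := h.map

theorem eq_of_eq (h : hN.Aut π ρ) {x c : ℕ} (hx : x ≤ d) (hc : ρ x = c) : π c = x := by
  rw [← hc, h.right_inv hx]

/-- `N (π 1)` is the adjacency relation of a path on which `ρ` is the coordinate. -/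
theorem near (h : hN.Aut π ρ) (hd : 1 ≤ d) {x y : ℕ} (hx : x ≤ d) (hy : y ≤ d)
    (hxy : N (π 1) x y) : ρ x ≤ ρ y + 1 ∧ ρ y ≤ ρ x + 1 := by
  have h1 := h.map_symm (h.le hd) hx hy hxy
  rw [h.left_inv hd] at h1
  have := hN.triangle h1
  omega

theorem near_of_add (h : hN.Aut π ρ) (hd : 1 ≤ d) {x y : ℕ} (hx : x ≤ d) (hy : y ≤ d)
    (hxy : π 1 + x = y ∨ x + y = π 1 ∨ y + π 1 = x) : ρ x ≤ ρ y + 1 ∧ ρ y ≤ ρ x + 1 :=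
  h.near hd hx hy (hN.of_add (h.le hd) hx hy hxy)

theorem symm_ne (h : hN.Aut π ρ) {x c : ℕ} (hx : x ≤ d) (hc : π c ≠ x) : ρ x ≠ c :=
  fun h0 => hc (h.eq_of_eq hx h0)

theorem inj (h : hN.Aut π ρ) {x y : ℕ} (hx : x ≤ d) (hy : y ≤ d) (hxy : x ≠ y) : ρ x ≠ ρ y :=
  fun h0 => hxy (by rw [← h.right_inv hx, h0, h.right_inv hy])

theorem pos (h : hN.Aut π ρ) {x : ℕ} (hx : x ≤ d) (h0 : x ≠ 0) : 0 < ρ x :=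
  Nat.pos_of_ne_zero (h.symm_ne hx (by rw [h.zero]; exact h0.symm))

theorem eq_self_of_one (h : hN.Aut π ρ) (hd : 1 ≤ d) (h1 : π 1 = 1) :
    ∀ i, i ≤ d → ρ i = i := by
  intro i
  induction i using Nat.strong_induction_on with
  | _ i ih =>
    intro hi
    rcases i with _ | i
    · exact h.symm.zero
    rcases i with _ | i
    · simpa [h1] using h.left_inv hd
    have e1 := ih (i + 1) (by omega) (by omega)
    have e2 := ih i (by omega) (by omega)
    have n := h.near_of_add hd (x := i + 1) (y := i + 1 + 1) (by omega) hi (by omega)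
    have i1 := h.inj hi (show i ≤ d by omega) (by omega)
    have i2 := h.inj hi (show i + 1 ≤ d by omega) (by omega)
    omega

/-- Write a = π 1, so ρ a = 1. Both a - 1 and a + 1 are near 1, so their ρ-values are the two
neighbours of ρ 1. If `N 1 a a` held, then ρ 1 = 2 and one neighbour would be 1 = ρ a. Hence `N 2 a
a`, which puts ρ 2 next to ρ a and forces ρ 2 = 2. -/
theorem middle (h : hN.Aut π ρ) (h2 : 2 < π 1) (hd : π 1 < d) :
    π 2 = 2 ∧ ρ 2 = 2 ∧ 2 < ρ 1 ∧ ρ 1 < d ∧ ¬N 1 1 1 ∧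
      ((ρ (π 1 - 1) = ρ 1 - 1 ∧ ρ (π 1 + 1) = ρ 1 + 1) ∨
        (ρ (π 1 - 1) = ρ 1 + 1 ∧ ρ (π 1 + 1) = ρ 1 - 1)) := by
  have hd1 : 1 ≤ d := by omega
  have hl := h.left_inv hd1
  set a := π 1 with ha
  have n1 := h.near_of_add hd1 (x := 1) (y := a - 1) (by omega) (by omega) (by omega)
  have n2 := h.near_of_add hd1 (x := 1) (y := a + 1) (by omega) (by omega) (by omega)
  have i1 := h.inj (x := a - 1) (y := 1) (by omega) (by omega) (by omega)
  have i2 := h.inj (x := a + 1) (y := 1) (by omega) (by omega) (by omega)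
  have i3 := h.inj (x := a + 1) (y := a - 1) (by omega) (by omega) (by omega)
  have i4 := h.inj (x := a + 1) (y := a) (by omega) (by omega) (by omega)
  have i5 := h.inj (x := a - 1) (y := a) (by omega) (by omega) (by omega)
  have i6 := h.inj (x := 1) (y := a) (by omega) (by omega) (by omega)
  have b1 := h.le_symm (i := a + 1) (by omega)
  have b2 := h.le_symm (i := a - 1) (by omega)
  have p1 := h.pos (x := 1) (by omega) (by omega)
  have haa : ¬N 1 a a := fun hc => by
    have := h.near hd1 (by omega) (by omega) (hN.swap hc)
    omega
  have h111 := hN.not_one (by omega) hd haa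
  have h2aa := hN.two (by omega) hd h111 haa
  have n3 := h.near hd1 (x := a) (y := 2) (by omega) (by omega) (hN.rotate (hN.rotate h2aa))
  have i7 := h.inj (x := 2) (y := a) (by omega) (by omega) (by omega)
  have i8 := h.inj (x := 2) (y := 1) (by omega) (by omega) (by omega)
  have p2 := h.pos (x := 2) (by omega) (by omega)
  have hr2 : ρ 2 = 2 := by omega
  refine ⟨h.eq_of_eq (by omega) hr2, hr2, by omega, by omega, h111, by omega⟩

theorem eq_pred_of_middle (h : hN.Aut π ρ) (h2 : 2 < π 1) (hd : π 1 < d) : π 1 = d - 1 := by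
  have hd1 : 1 ≤ d := by omega
  -- Both a - 2 and a + 2 are near 2, and ρ 2 = 2, so they compete for the value 3 unless a - 2 = 2.
  -- If also 8 ≤ d, then 2a = 8 is near a and no value is left for it. Only d = 6 and d = 7 remain.
  have hstep : ∀ {π ρ : ℕ → ℕ}, hN.Aut π ρ → 2 < π 1 → π 1 < d →
      (π 1 ≠ 4 → ρ (π 1 - 2) = 3) ∧ (π 1 + 2 ≤ d → π 1 = 4 ∧ ρ 6 = 3 ∧ d < 8) := by
    intro π ρ h h2 hd
    obtain ⟨-, hr2, -⟩ := h.middle h2 hd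
    have hl := h.left_inv hd1
    set a := π 1 with ha
    have n1 := h.near_of_add hd1 (x := 2) (y := a - 2) (by omega) (by omega) (by omega)
    have i1 := h.inj (x := a - 2) (y := a) (by omega) (by omega) (by omega)
    have hA : a ≠ 4 → ρ (a - 2) = 3 := fun h4 => by
      have i2 := h.inj (x := a - 2) (y := 2) (by omega) (by omega) (by omega)
      omega
    refine ⟨hA, fun hle => ?_⟩
    have n2 := h.near_of_add hd1 (x := 2) (y := a + 2) (by omega) (by omega) (by omega)
    have i3 := h.inj (x := a + 2) (y := a) (by omega) (by omega) (by omega)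
    have i4 := h.inj (x := a + 2) (y := 2) (by omega) (by omega) (by omega)
    have i5 := h.inj (x := a + 2) (y := a - 2) (by omega) (by omega) (by omega)
    have h4 : a = 4 := by omega
    have h6 : ρ (a + 2) = 3 := by omega
    refine ⟨h4, by rw [h4] at h6; exact h6, ?_⟩
    by_contra! h8
    have n3 := h.near_of_add hd1 (x := a) (y := 2 * a) (by omega) (by omega) (by omega)
    have i6 := h.inj (x := 2 * a) (y := a) (by omega) (by omega) (by omega)
    have i7 := h.inj (x := 2 * a) (y := 2) (by omega) (by omega) (by omega)
    have p := h.pos (x := 2 * a) (by omega) (by omega)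
    omega
  by_contra hne
  obtain ⟨-, -, hb2, hbd, -⟩ := h.middle h2 hd
  obtain ⟨-, s2⟩ := hstep h h2 hd
  obtain ⟨s3, s4⟩ := hstep h.symm hb2 hbd
  obtain ⟨h4, h63, h8⟩ := s2 (by omega)
  have h36 : π 3 = 6 := h.eq_of_eq (by omega) h63
  by_cases hb : ρ 1 + 2 ≤ d
  · obtain ⟨hb4, -⟩ := s4 hb
    have h41 : π 4 = 1 := h.eq_of_eq (by omega) hb4
    have h0 := h.map (by omega) (by omega) (by omega) (hN.add (show 1 + 3 ≤ d by omega))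
    rw [h4, h36, h41] at h0
    have := hN.triangle h0
    omega
  · have hb' : ρ 1 = d - 1 := by omega
    have h3 := s3 (by omega)
    rcases (by omega : d = 6 ∨ d = 7) with rfl | rfl
    · rw [hb'] at h3
      norm_num at h3
      omega
    · rw [hb'] at h3
      norm_num at h3
      have h34 : ρ 3 = 4 := h.symm.eq_of_eq (by omega) h3
      have n1 := h.near_of_add hd1 (x := 3) (y := 1) (by omega) (by omega) (by omega)
      omega

theorem last_of_middle (h : hN.Aut π ρ) (h2 : 2 < π 1) (hd : π 1 < d) : π d = d := by
  obtain ⟨hp2, hr2, hb2, hbd, h111, hor⟩ := h.middle h2 hd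
  have ha := h.eq_pred_of_middle h2 hd
  have hb := h.symm.eq_pred_of_middle hb2 hbd
  have hd4 : 4 ≤ d := by omega
  rw [ha, hb, Nat.sub_add_cancel (by omega), Nat.sub_sub] at hor
  rcases hor with ⟨-, h0⟩ | ⟨h1, h0⟩
  · exact h.eq_of_eq le_rfl h0
  exfalso
  -- The image of (2, d - 2, d - 4) forces ρ (d - 4) ≥ d - 2. The only free value is d - 1 = ρ 1, so
  -- d = 5, and that case is excluded by `three`.
  have t1 := h.map_symm (by omega) (by omega) (by omega)
    (hN.of_add (i := 2) (j := d - (1 + 1)) (k := d - 4) (by omega) (by omega) (by omega) (by omega))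
  rw [hr2, h1] at t1
  have t2 := hN.triangle t1
  have b := h.le_symm (i := d - 4) (by omega)
  have i1 := h.inj (x := d - 4) (y := d) (by omega) (by omega) (by omega)
  have i2 := h.inj (x := d - 4) (y := d - (1 + 1)) (by omega) (by omega) (by omega)
  have h5 : d = 5 := by
    by_contra h5
    have i3 := h.inj (x := d - 4) (y := 1) (by omega) (by omega) (by omega)
    omega
  subst h5
  have t3 := h.map_symm (by omega) (by omega) (by omega) (hN.rotate (hN.add (show 2 + 2 ≤ 5 by omega)))
  have h41 : ρ 4 = 1 := h.symm.eq_of_eq (by omega) ha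
  norm_num at t3 h1
  rw [h41, hr2] at t3
  have t4 := h.map_symm (by omega) (by omega) (by omega) (hN.three (by omega) h111 t3)
  rw [hr2, h1] at t4
  have := hN.triangle t4
  omega

theorem last_of_two (h : hN.Aut π ρ) (hd : 3 ≤ d) (h2 : π 1 = 2) : π d = d := by
  have hd1 : 1 ≤ d := by omega
  have hr : ρ 2 = 1 := by simpa [h2] using h.left_inv hd1
  by_cases h122 : N 1 2 2
  · have n1 := h.near hd1 (x := 2) (y := 1) (by omega) (by omega)
      (h2.symm ▸ hN.rotate (hN.rotate h122))
    have p1 := h.pos (x := 1) (by omega) (by omega)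
    have i1 := h.inj (x := 1) (y := 2) (by omega) (by omega) (by omega)
    have hr1 : ρ 1 = 2 := by omega
    have hp2 := h.eq_of_eq (by omega) hr1
    rcases hd.eq_or_lt with rfl | hd4
    · have b := h.le (i := 3) le_rfl
      have p3 := h.symm.pos (x := 3) le_rfl (by omega)
      have j1 := h.symm.inj (x := 3) (y := 1) le_rfl (by omega) (by omega)
      have j2 := h.symm.inj (x := 3) (y := 2) le_rfl (by omega) (by omega)
      omega
    · exfalso
      have n2 := h.near_of_add hd1 (x := 2) (y := 4) (by omega) (by omega) (by omega)
      have p4 := h.pos (x := 4) (by omega) (by omega)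
      have i2 := h.inj (x := 4) (y := 2) (by omega) (by omega) (by omega)
      have i3 := h.inj (x := 4) (y := 1) (by omega) (by omega) (by omega)
      omega
  · exfalso
    have h111 := hN.not_one (by omega) (by omega) h122
    have h222 := h.map_symm (by omega) (by omega) (by omega)
      (hN.two (by omega) (by omega) h111 h122)
    rw [hr] at h222
    exact h111 h222

/-- With e = ρ 2, both π (e ± 1) are at least d - 2. The values d and d - 1 are taken at 1 and d - 1
only, so e is adjacent to 1 or to d - 1. -/
theorem two_of_one_eq_last (h : hN.Aut π ρ) (hd : 6 ≤ d) (h1 : π 1 = d) (h1' : ρ 1 = d) :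
    ρ 2 = 2 ∨ (ρ 2 = d - 2 ∧ π (d - 3) = d - 2) := by
  have hd1 : 1 ≤ d := by omega
  have hrd : ρ d = 1 := by simpa [h1] using h.left_inv hd1
  have hpd : π d = 1 := h.eq_of_eq hd1 h1'
  have n1 := h.near_of_add hd1 (x := 1) (y := d - 1) (by omega) (by omega) (by omega)
  have b1 := h.le_symm (i := d - 1) (by omega)
  have i1 := h.inj (x := d - 1) (y := 1) (by omega) (by omega) (by omega)
  have hrd1 : ρ (d - 1) = d - 1 := by omega
  have hpd1 := h.eq_of_eq (by omega) hrd1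
  have p2 := h.pos (x := 2) (by omega) (by omega)
  have b2 := h.le_symm (i := 2) (by omega)
  have i2 := h.inj (x := 2) (y := 1) (by omega) (by omega) (by omega)
  have i3 := h.inj (x := 2) (y := d) (by omega) (by omega) (by omega)
  have hp2 := h.right_inv (i := 2) (by omega)
  set e := ρ 2 with he
  have t1 := h.map (by omega) (by omega) (by omega)
    (hN.of_add (i := 1) (j := e) (k := e + 1) (by omega) (by omega) (by omega) (by omega))
  have t2 := h.map (by omega) (by omega) (by omega)
    (hN.of_add (i := 1) (j := e) (k := e - 1) (by omega) (by omega) (by omega) (by omega))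
  rw [h1, hp2] at t1 t2
  have t1 := hN.triangle t1
  have t2 := hN.triangle t2
  have c1 := h.le (i := e + 1) (by omega)
  have c2 := h.le (i := e - 1) (by omega)
  have j0 := h.symm.inj (x := e + 1) (y := e - 1) (by omega) (by omega) (by omega)
  have j1 := h.symm.inj (x := e + 1) (y := 1) (by omega) (by omega) (by omega)
  by_cases he2 : e = 2
  · exact Or.inl he2
  have j2 := h.symm.inj (x := e - 1) (y := 1) (by omega) (by omega) (by omega)
  have j3 := h.symm.inj (x := e - 1) (y := d - 1) (by omega) (by omega) (by omega)
  by_cases he3 : e = d - 2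
  · refine Or.inr ⟨he3, ?_⟩
    rw [show d - 3 = e - 1 by omega]
    omega
  · exfalso
    have j4 := h.symm.inj (x := e + 1) (y := d - 1) (by omega) (by omega) (by omega)
    omega

theorem reflect_of_one_eq_last (h : hN.Aut π ρ) (hd : 6 ≤ d) (h1 : π 1 = d) (h1' : ρ 1 = d)
    (i : ℕ) : 2 * i ≤ d → (Even i → π i = i ∧ ρ i = i) ∧
      (Odd i → π i = d + 1 - i ∧ ρ i = d + 1 - i) := by
  have hd1 : 1 ≤ d := by omega
  have h2 : ρ 2 = 2 := by
    rcases h.two_of_one_eq_last hd h1 h1' with h0 | ⟨-, h0⟩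
    · exact h0
    · rcases h.symm.two_of_one_eq_last hd h1' h1 with h3 | ⟨h3, -⟩
      · exact h.symm.eq_of_eq (by omega) h3
      · have := h.symm.inj (x := d - 3) (y := 2) (by omega) (by omega) (by omega)
        omega
  have h2' : π 2 = 2 := h.eq_of_eq (by omega) h2
  -- Even step: ρ (j + 2) is within 2 of j, and all other such values are already taken.
  have hE : ∀ {π ρ : ℕ → ℕ}, hN.Aut π ρ → ρ 2 = 2 → ∀ j, Even j → 2 * (j + 2) ≤ d →
      (∀ k, k < j + 2 → (Even k → π k = k ∧ ρ k = k) ∧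
        (Odd k → π k = d + 1 - k ∧ ρ k = d + 1 - k)) → ρ (j + 2) = j + 2 := by
    intro π ρ h h2 j hj hjd ih
    have e0 := ((ih j (by omega)).1 hj).2
    have e1 := ((ih (j + 1) (by omega)).2 hj.add_one).1
    have t := h.map_symm (by omega) (by omega) (by omega)
      (hN.of_add (i := 2) (j := j) (k := j + 2) (by omega) (by omega) (by omega) (by omega))
    rw [h2, e0] at t
    have t := hN.triangle t
    have i0 := h.inj (x := j + 2) (y := j) (by omega) (by omega) (by omega)
    have s1 := h.symm_ne (x := j + 2) (c := j + 1) (by omega) (by omega)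
    rcases Nat.eq_zero_or_pos j with rfl | hjpos
    · exact h2
    have hj2 : 2 ≤ j := by obtain ⟨c, rfl⟩ := hj; omega
    have e2 := ((ih (j - 1) (by omega)).2 (Nat.Even.sub_odd (by omega) hj odd_one)).1
    have e3 := ((ih (j - 2) (by omega)).1 (Nat.even_sub hj2 |>.mpr (by simp [hj]))).2
    have s2 := h.symm_ne (x := j + 2) (c := j - 1) (by omega) (by omega)
    have i1 := h.inj (x := j + 2) (y := j - 2) (by omega) (by omega) (by omega)
    omega
  -- Odd step: d - (j + 1) is near the fixed point j + 1 because they add up to π 1 = d, and j is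
  -- taken, so its ρ-value is j + 2.
  have hO : ∀ {π ρ : ℕ → ℕ}, hN.Aut π ρ → π 1 = d → ∀ j, Odd j → 2 * (j + 2) ≤ d →
      (∀ k, k < j + 2 → (Even k → π k = k ∧ ρ k = k) ∧
        (Odd k → π k = d + 1 - k ∧ ρ k = d + 1 - k)) → π (j + 2) = d + 1 - (j + 2) := by
    intro π ρ h h1 j hj hjd ih
    have e0 := ((ih j (by omega)).2 hj).1
    have e1 := ((ih (j + 1) (by omega)).1 hj.add_one).2
    have n := h.near_of_add hd1 (x := j + 1) (y := d - (j + 1)) (by omega) (by omega) (by omega)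
    have s := h.symm_ne (x := d - (j + 1)) (c := j) (by omega) (by omega)
    have i0 := h.inj (x := d - (j + 1)) (y := j + 1) (by omega) (by omega) (by omega)
    have := h.eq_of_eq (x := d - (j + 1)) (c := j + 2) (by omega) (by omega)
    omega
  induction i using Nat.strong_induction_on with
  | _ i ih =>
    intro hi
    rcases i with _ | i
    · exact ⟨fun _ => ⟨h.zero, h.symm.zero⟩, fun h0 => absurd h0 (by decide)⟩
    rcases i with _ | i
    · exact ⟨fun h0 => absurd h0 (by decide), fun _ => ⟨by simpa using h1, by simpa using h1'⟩⟩
    have ih1 := fun k (hk : k < i + 2) => ih k hk (by omega)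
    have ih2 := fun k (hk : k < i + 2) => show (Even k → ρ k = k ∧ π k = k) ∧
        (Odd k → ρ k = d + 1 - k ∧ π k = d + 1 - k) from
      ⟨fun hk' => ((ih1 k hk).1 hk').symm, fun hk' => ((ih1 k hk).2 hk').symm⟩
    constructor
    · intro he
      have he' : Even i := by simpa [Nat.even_add_one] using he
      exact ⟨hE h.symm h2' i he' hi ih2, hE h h2 i he' hi ih1⟩
    · intro ho
      have ho' : Odd i := by simpa [Nat.odd_add_one] using ho
      exact ⟨hO h h1 i ho' hi ih1, hO h.symm h1' i ho' hi ih2⟩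

/-- If d moves, the cases π 1 = 1, π 1 = 2 and 2 < π 1 < d are excluded, so π 1 = d, and likewise ρ
1 = d. For d < 6 only t = 1 is in range. -/
theorem last_or_reflect (h : hN.Aut π ρ) (hd : 2 ≤ d) :
    π d = d ∨ ∀ t, Odd t → 2 * t ≤ d → π t = d + 1 - t := by
  by_contra! hcon
  obtain ⟨hlast, t, hodd, htd, hne⟩ := hcon
  have hd1 : 1 ≤ d := by omega
  have hone : ∀ {π ρ : ℕ → ℕ}, hN.Aut π ρ → π d ≠ d → π 1 = d := by
    intro π ρ h hlast
    have b := h.le hd1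
    have p := h.symm.pos hd1 one_ne_zero
    have c1 : π 1 ≠ 1 := fun h1 => hlast (h.eq_of_eq le_rfl (h.eq_self_of_one hd1 h1 d le_rfl))
    by_contra h1
    have c2 : π 1 ≠ 2 := fun h2 => hlast (h.last_of_two (by omega) h2)
    exact hlast (h.last_of_middle (by omega) (by omega))
  have h1 := hone h hlast
  have h1' := hone h.symm (h.symm_ne le_rfl hlast)
  rcases le_or_gt 6 d with h6 | h6
  · exact hne ((h.reflect_of_one_eq_last h6 h1 h1' t htd).2 hodd).1
  · obtain ⟨c, rfl⟩ := hodd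
    have : c = 0 := by omega
    subst this
    exact hne (by simpa using h1)

end Aut

end IsKreinPattern

end

/-! ### Automorphisms of ℂ and rational integers. -/

/-- An automorphism of a subfield of the complex numbers extends to the complex numbers. -/
theorem Complex.exists_ringEquiv_extends (L : IntermediateField ℚ ℂ) (τ : L ≃+* L) :
    ∃ σ : ℂ ≃+* ℂ, ∀ x : L, σ x = τ x := by
  -- Let τ act on the coefficients of the polynomial ring L[s], then extend to ℂ, which is an
  -- algebraic closure of it.
  obtain ⟨s, hs⟩ := exists_isTranscendenceBasis L ℂ
  have := IsAlgClosed.isAlgClosure_of_transcendence_basis _ hs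
  have hind := hs.1
  let e : Algebra.adjoin L (Set.range ((↑) : s → ℂ)) ≃+* Algebra.adjoin L (Set.range ((↑) : s → ℂ)) :=
    hind.aevalEquiv.symm.toRingEquiv.trans
      ((MvPolynomial.mapEquiv s τ).trans hind.aevalEquiv.toRingEquiv)
  refine ⟨IsAlgClosure.equivOfEquiv ℂ ℂ e, fun x => ?_⟩
  have h := IsAlgClosure.equivOfEquiv_algebraMap ℂ ℂ e (algebraMap L _ x)
  have h1 : e (algebraMap L _ x) = algebraMap L _ (τ x) := by
    change hind.aevalEquiv (MvPolynomial.map (τ : L →+* L)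
      (hind.aevalEquiv.symm (algebraMap L _ x))) = _
    rw [AlgEquiv.commutes, MvPolynomial.algebraMap_eq, MvPolynomial.map_C,
      ← MvPolynomial.algebraMap_eq, AlgEquiv.commutes]
    rfl
  rw [h1, ← IsScalarTower.algebraMap_apply, ← IsScalarTower.algebraMap_apply] at h
  exact h

/-- Every automorphism of the algebraic closure of ℚ in ℂ extends to ℂ, so z is fixed by the
absolute Galois group. It is therefore rational, and ℤ is integrally closed. -/
theorem Complex.exists_intCast_of_isIntegral {z : ℂ} (hz : IsIntegral ℤ z)
    (h : ∀ σ : ℂ ≃+* ℂ, σ z = z) : ∃ n : ℤ, z = n := by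
  let L := algebraicClosure ℚ ℂ
  have hzQ : IsIntegral ℚ z := hz.tower_top
  have hzL : z ∈ L := mem_algebraicClosure_iff.mpr hzQ.isAlgebraic
  have hbot : (⟨z, hzL⟩ : L) ∈ (⊥ : IntermediateField ℚ L) := by
    have : IsAlgClosure ℚ L := algebraicClosure.isAlgClosure ℚ ℂ
    have : IsGalois ℚ L := IsAlgClosure.isGalois ℚ L
    rw [InfiniteGalois.mem_bot_iff_fixed]
    intro τ
    obtain ⟨σ, hσ⟩ := Complex.exists_ringEquiv_extends L τ.toRingEquiv
    have := hσ ⟨z, hzL⟩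
    rw [h σ] at this
    exact Subtype.ext this.symm
  obtain ⟨r, hr⟩ := IntermediateField.mem_bot.mp hbot
  have hr' : (r : ℂ) = z := by
    have := congrArg (algebraMap L ℂ) hr
    rw [← IsScalarTower.algebraMap_apply] at this
    simpa using this
  have hrint : IsIntegral ℤ r := by
    rw [← hr'] at hz
    exact (isIntegral_algebraMap_iff (algebraMap ℚ ℂ).injective).mp (by simpa using hz)
  obtain ⟨n, hn⟩ := IsIntegrallyClosed.isIntegral_iff.mp hrint
  exact ⟨n, by rw [← hr', ← hn]; simp⟩

/-! ### The action of field automorphisms on the scheme, and the main theorem. -/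

namespace SymmAssocScheme

variable {X : Type*} [Fintype X] {d : ℕ}

theorem A_map (S : SymmAssocScheme X d) (i : Fin (d + 1)) (σ : ℂ ≃+* ℂ) :
    (S.A i).map σ = S.A i := by
  ext x y
  simp only [A, Matrix.map_apply, Matrix.of_apply]
  split_ifs <;> simp

variable [DecidableEq X]

theorem map_mem (S : SymmAssocScheme X d) {M : Matrix X X ℂ} (hM : M ∈ S.boseMesner)
    (σ : ℂ ≃+* ℂ) : M.map σ ∈ S.boseMesner := by
  obtain ⟨c, rfl⟩ := S.mem_boseMesner_iff.mp hM
  refine S.mem_boseMesner_iff.mpr ⟨fun i => σ (c i), ?_⟩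
  ext x y
  obtain ⟨k, hk⟩ := S.exists_mem x y
  rw [Matrix.map_apply, S.sum_A_apply _ hk, S.sum_A_apply _ hk]

theorem isIntegral_A (S : SymmAssocScheme X d) (i : Fin (d + 1)) : IsIntegral ℤ (S.A i) := by
  classical
  let M : Matrix X X ℤ := Matrix.of fun x y => if (x, y) ∈ S.R i then 1 else 0
  have h : S.A i = (Int.castRingHom ℂ).mapMatrix M := by
    ext x y
    by_cases hx : (x, y) ∈ S.R i <;> simp [A, M, hx]
  rw [h]
  exact (Matrix.isIntegral M).map ((Int.castRingHom ℂ).mapMatrix.toIntAlgHom)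

namespace PrimitiveIdempotents

variable {S : SymmAssocScheme X d} (B : S.PrimitiveIdempotents)

theorem isIntegral_p (j k : Fin (d + 1)) : IsIntegral ℤ (B.p j k) := by
  obtain ⟨f, hf, hf0⟩ := S.isIntegral_A j
  refine ⟨f, hf, ?_⟩
  rw [← Polynomial.aeval_def] at hf0 ⊢
  have h : ∀ g : Polynomial ℤ,
      Polynomial.aeval (S.A j) g * B.E k = Polynomial.aeval (B.p j k) g • B.E k := by
    intro g
    induction g using Polynomial.induction_on' with
    | add g₁ g₂ h₁ h₂ => simp [add_mul, h₁, h₂, add_smul]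
    | monomial n a =>
      have hpow : S.A j ^ n * B.E k = B.p j k ^ n • B.E k := by
        induction n with
        | zero => simp
        | succ n ih =>
          rw [pow_succ, Matrix.mul_assoc, B.A_mul_E, mul_smul_comm, ih, smul_smul, pow_succ, mul_comm]
      rw [Polynomial.aeval_monomial, Polynomial.aeval_monomial, Matrix.mul_assoc, hpow, mul_smul,
        ← Algebra.smul_def, algebraMap_smul]
  have h0 := h f
  rw [hf0, zero_mul] at h0
  exact (smul_eq_zero.mp h0.symm).resolve_right (B.E_ne_zero k)

/-- A field automorphism permutes the primitive idempotents. -/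
theorem exists_perm (σ : ℂ ≃+* ℂ) :
    ∃ e : Equiv.Perm (Fin (d + 1)), ∀ i, (B.E i).map σ = B.E (e i) := by
  choose c hc using fun i => B.mem_boseMesner_iff.mp (S.map_mem (B.E_mem i) σ)
  have hmul : ∀ i j k, c i k * c j k = if i = j then c i k else 0 := by
    intro i j k
    have h1 : (B.E i).map σ * (B.E j).map σ = if i = j then (B.E i).map σ else 0 := by
      rw [← Matrix.map_mul, B.mul_eq]
      split_ifs <;> simp
    have h2 := congrArg (· * B.E k) h1
    simp only [Matrix.mul_assoc, hc, ite_mul, zero_mul, B.sum_smul_E_mul_E, mul_smul_comm,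
      smul_smul] at h2
    refine smul_left_injective ℂ (B.E_ne_zero k) ?_
    simp only
    rw [mul_comm, h2]
    split_ifs <;> simp
  have hne : ∀ i, ∃ k, c i k ≠ 0 := by
    intro i
    by_contra! h
    refine B.E_ne_zero i ?_
    have h1 := hc i
    simp only [h, zero_smul, Finset.sum_const_zero] at h1
    ext x y
    have := congrFun (congrFun h1 x) y
    simpa using this
  -- The coefficient supports of the d + 1 conjugated idempotents are nonempty and pairwise disjoint
  -- in a set of size d + 1, hence singletons.
  choose f hf using hne
  have hinj : Function.Injective f := by
    intro i j hij
    by_contra h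
    have := hmul i j (f i)
    rw [if_neg h] at this
    rcases mul_eq_zero.mp this with h0 | h0
    · exact hf i h0
    · exact hf j (hij ▸ h0)
  have hbij : Function.Bijective f := Finite.injective_iff_bijective.mp hinj
  refine ⟨Equiv.ofBijective f hbij, fun i => ?_⟩
  rw [hc, Finset.sum_eq_single (f i)]
  · have h1 := hmul i i (f i)
    rw [if_pos rfl] at h1
    rw [mul_left_cancel₀ (hf i) (h1.trans (mul_one _).symm), one_smul]
    rfl
  · intro k _ hk
    obtain ⟨j, rfl⟩ := hbij.2 k
    have hij : i ≠ j := fun h => hk (h ▸ rfl)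
    have h1 := hmul i j (f j)
    rw [if_neg hij] at h1
    rw [(mul_eq_zero.mp h1).resolve_right (hf j), zero_smul]
  · simp

variable {B}

theorem E_injective : Function.Injective B.E := B.linearIndependent.injective

theorem perm_zero {σ : ℂ ≃+* ℂ} {e : Equiv.Perm (Fin (d + 1))}
    (he : ∀ i, (B.E i).map σ = B.E (e i)) : e 0 = 0 := by
  refine E_injective (B := B) ?_
  rw [← he, B.zero_eq]
  ext x y
  simp

/-- Multiplicities are ranks, hence natural numbers, which σ fixes. -/
theorem m_perm {σ : ℂ ≃+* ℂ} {e : Equiv.Perm (Fin (d + 1))}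
    (he : ∀ i, (B.E i).map σ = B.E (e i)) (i : Fin (d + 1)) : B.m (e i) = B.m i := by
  have h : ((B.E i).map σ).trace = σ (B.E i).trace := by simp [Matrix.trace]
  rw [B.m_eq_trace, B.m_eq_trace, ← he, h, B.trace_E_eq_rank, map_natCast]

theorem p_perm {σ : ℂ ≃+* ℂ} {e : Equiv.Perm (Fin (d + 1))}
    (he : ∀ i, (B.E i).map σ = B.E (e i)) (j i : Fin (d + 1)) : B.p j (e i) = σ (B.p j i) := by
  have h : (S.A j * B.E i).map σ = (B.p j i • B.E i).map σ := by rw [B.A_mul_E]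
  rw [Matrix.map_mul, S.A_map, he, B.A_mul_E] at h
  refine smul_left_injective ℂ (B.E_ne_zero (e i)) (h.trans ?_)
  rw [← he]
  ext x y
  simp

/-- A permutation of `Fin (d + 1)` as a function on natural numbers. -/
def natPerm (e : Equiv.Perm (Fin (d + 1))) (i : ℕ) : ℕ :=
  if h : i < d + 1 then (e ⟨i, h⟩ : ℕ) else i

theorem natPerm_of_le (e : Equiv.Perm (Fin (d + 1))) {i : ℕ} (h : i ≤ d) :
    natPerm e i = e ⟨i, Nat.lt_succ_of_le h⟩ := dif_pos _

theorem natPerm_le (e : Equiv.Perm (Fin (d + 1))) {i : ℕ} (h : i ≤ d) : natPerm e i ≤ d := by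
  rw [natPerm_of_le e h]
  exact Nat.le_of_lt_succ (e _).2

theorem natPerm_symm (e : Equiv.Perm (Fin (d + 1))) {i : ℕ} (h : i ≤ d) :
    natPerm e.symm (natPerm e i) = i := by
  rw [natPerm_of_le _ (natPerm_le e h)]
  simp [natPerm_of_le e h]

theorem triple_natPerm {σ : ℂ ≃+* ℂ} {e : Equiv.Perm (Fin (d + 1))}
    (he : ∀ i, (B.E i).map σ = B.E (e i)) {i j k : ℕ} (hi : i ≤ d) (hj : j ≤ d) (hk : k ≤ d) :
    B.triple (natPerm e i) (natPerm e j) (natPerm e k) = σ (B.triple i j k) := by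
  have h : ∀ {l}, l ≤ d → B.idem (natPerm e l) = (B.idem l).map σ := fun hl => by
    rw [natPerm_of_le e hl, B.idem_val, ← he, B.idem_of_le hl]
  simp [triple, h hi, h hj, h hk]

theorem IsQPolynomial.isKreinPattern (hQ : B.IsQPolynomial) (hm : (B.idem 1).trace ≠ 2) :
    IsKreinPattern d fun i j k => B.triple i j k ≠ 0 where
  swap := fun h => B.triple_swap _ _ _ ▸ h
  rotate := fun h => B.triple_rotate _ _ _ ▸ h
  le_add := hQ.le_of_triple_ne_zero
  add := hQ.triple_add_ne_zero
  not_one := by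
    intro i hi hd h
    obtain ⟨r, rfl⟩ := Nat.exists_eq_add_of_le' hi
    exact not_not.mpr (hQ.triple_one_one_one_eq_zero (by omega) (not_not.mp h))
  two := by
    intro i hi hd h1 h
    obtain ⟨r, rfl⟩ := Nat.exists_eq_add_of_le' hi
    exact hQ.triple_two_ne_zero hm (by omega) (not_not.mp h1) (not_not.mp h)
  three := fun hd h1 h2 => hQ.triple_two_two_three_ne_zero hd (not_not.mp h1) h2

theorem aut_natPerm {σ : ℂ ≃+* ℂ} {e : Equiv.Perm (Fin (d + 1))}
    (he : ∀ i, (B.E i).map σ = B.E (e i)) (hN : IsKreinPattern d fun i j k => B.triple i j k ≠ 0) :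
    hN.Aut (natPerm e) (natPerm e.symm) where
  le := natPerm_le e
  le_symm := natPerm_le e.symm
  left_inv := natPerm_symm e
  right_inv := natPerm_symm e.symm
  zero := by
    rw [natPerm_of_le e (Nat.zero_le d)]
    exact congrArg Fin.val (perm_zero he)
  map := by
    intro i j k hi hj hk h
    rw [triple_natPerm he hi hj hk]
    simpa using h
  map_symm := by
    intro i j k hi hj hk h h0
    apply h
    rw [← natPerm_symm e.symm hi, ← natPerm_symm e.symm hj, ← natPerm_symm e.symm hk]
    rw [Equiv.symm_symm, triple_natPerm he (natPerm_le _ hi) (natPerm_le _ hj) (natPerm_le _ hk),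
      h0, map_zero]

end PrimitiveIdempotents

end SymmAssocScheme

theorem mainTheorem3 {X : Type*} [Fintype X] [DecidableEq X] {d : ℕ}
    (S : SymmAssocScheme X d) (B : S.PrimitiveIdempotents) (hQ : B.IsQPolynomial)
    (hm : 2 < (B.m 1).re)
    (ht : ∃ t s : Fin (d + 1), Odd (t : ℕ) ∧ 2 * (t : ℕ) ≤ d ∧ (s : ℕ) = d - (t : ℕ) + 1 ∧
      B.m t ≠ B.m s) :
    ∀ j : Fin (d + 1), j ≠ 0 →
      B.K j = -B.p j (Fin.last d) ∧ ∃ n : ℤ, B.K j = (n : ℂ) := by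
  intro j hj
  refine ⟨hQ.K_eq hj, ?_⟩
  obtain ⟨t, s, hodd, htd, hs, hne⟩ := ht
  have hd : 2 ≤ d := by have := hodd.pos; omega
  have hm1 : (B.idem 1).trace ≠ 2 := by
    have h1 : (⟨1, by omega⟩ : Fin (d + 1)) = 1 := by
      obtain ⟨k, rfl⟩ := Nat.exists_eq_add_of_le' hd
      rfl
    rw [B.idem_of_le (show 1 ≤ d by omega), h1, ← B.m_eq_trace]
    intro h
    rw [h] at hm
    simp at hm
  have hfix : ∀ σ : ℂ ≃+* ℂ, σ (B.p j (Fin.last d)) = B.p j (Fin.last d) := by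
    intro σ
    obtain ⟨e, he⟩ := B.exists_perm σ
    rw [← SymmAssocScheme.PrimitiveIdempotents.p_perm he]
    congr 1
    -- In the reflecting case t would go to s = d - t + 1, giving m_t = m_s.
    rcases (SymmAssocScheme.PrimitiveIdempotents.aut_natPerm he
      (hQ.isKreinPattern hm1)).last_or_reflect hd with h | h
    · rw [SymmAssocScheme.PrimitiveIdempotents.natPerm_of_le e le_rfl] at h
      exact Fin.ext h
    · exfalso
      have h1 := h t hodd htd
      rw [SymmAssocScheme.PrimitiveIdempotents.natPerm_of_le e (by omega)] at h1
      have h2 : e t = s := Fin.ext (by rw [hs]; simp only [Fin.eta] at h1; omega)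
      exact hne (by rw [← h2, SymmAssocScheme.PrimitiveIdempotents.m_perm he])
  obtain ⟨n, hn⟩ := Complex.exists_intCast_of_isIntegral (B.isIntegral_p j (Fin.last d)) hfix
  exact ⟨-n, by rw [hQ.K_eq hj, hn]; simp⟩
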